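/- **Conventions.** Let $S_n$ act on $\mathbb{N}_n=\{1,\dots,n\}$, let $S_{\mathbb{N}}$ be the group of all permutations of $\mathbb{N}=\{1,2,\dots\}$, and let $S_\infty=\bigcup_n S_n\subseteq S_{\mathbb{N}}$ be the subgroup of permutations fixing all but finitely many integers. Permutations act on polynomials and on power series by $x_i\mapsto x_{\sigma(i)}$. For $\hat w\in S_\infty$ put $\operatorname{Dsl}(\hat w)=\{i\ge 1: \hat w(i+1)<\hat w(i)\}$, a finite set. For a standard tableau $S$ (English notation) with $n$ boxes, write $R_S(i),C_S(i)$ for the row and column of $i$; $\operatorname{Dsi}(S)$ is the set of $1\le i<n$ with $R_S(i+1)>R_S(i)$ and $C_S(i+1)\le C_S(i)$, and $\operatorname{ct}(S)$ is obtained from $S$ by replacing each entry $p$ by $|\{i\in\operatorname{Dsi}(S): i<p\}|$. For a tableau $T$ of the same shape with entries $1,\dots,n$, let $R(T),C(T)\le S_n$ be the subgroups preserving its rows and its columns, let $p_T^S=\prod_i x_i^{h_i}$, where $h_i$ is the entry of $\operatorname{ct}(S)$ in the box of $T$ containing $i$, let $s_T^S$ be the order of the stabilizer of $p_T^S$ in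 $R(T)$, and let $$F_T^S=\frac1{s_T^S}\sum_{\sigma\in C(T)}\sum_{\tau\in R(T)}\operatorname{sgn}(\sigma)\,\sigma\tau\, p_T^S\in\mathbb{Q}[x_1,\dots,x_n].$$ For $w\in S_n$ with Robinson–Schensted tableaux $P(w),Q(w)$, the higher Specht polynomial of $w$ is $F_w=F_{P(w)}^{\operatorname{ev}Q(w)}$, with $\operatorname{ev}$ the Schützenberger evacuation. The extended column group $\tilde C(T)$ is generated by $C(T)$ and by the permutations that interchange whole columns of $T$ of equal length, keeping every entry in its row; $\widetilde{\operatorname{sgn}}:\tilde C(T)\to\{\pm1\}$ is the character that equals $\operatorname{sgn}$ on $C(T)$ and $1$ on the permutations of whole columns. **Theorem.** Let $\hat w\in S_\infty$. There is a power series $F_{\hat w}$ over $\mathbb{Q}$ in the infinitely many variables $x_1,x_2,\dots$ with the following properties. 1. $F_{\hat w}$ is homogeneous of degree $d=\sum_{i\in\operatorname{Dsl}(\hat w)}i$. 2. For every $n$ such that $\hat w$ is the image of some $w_n\in S_n$, substituting $x_m=0$ for all $m>n$ in $F_{\hat w}$ yields the higher Specht polynomial $F_{w_n}$. 3. For every such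 $n$, with $T_n=P(w_n)$, the image of $\tilde C(T_n)$ in $S_\infty$ acts on $F_{\hat w}$ via the character $\widetilde{\operatorname{sgn}}$ (which is well defined). 4. For every such $n$, every element of $S_{\mathbb{N}}$ (in particular of $S_\infty$) that fixes all the numbers in $\mathbb{N}_n$ leaves $F_{\hat w}$ invariant. Moreover, for large $n$ these properties determine $F_{\hat w}$ from $F_{w_n}$: for every $m$ such that $\hat w$ comes from $S_m$ there is an $N$ such that for every $n\ge N$ for which $\hat w$ is the image of some $w_n\in S_n$, the series $F_{\hat w}$ is the only power series over $\mathbb{Q}$ that is homogeneous of degree $d$, becomes $F_{w_n}$ after substituting $x_l=0$ for all $l>n$, and is invariant under all the elements of $S_\infty$ that fix every number in $\mathbb{N}_m$. -/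

import Mathlib

/-!
Conventions. All indices start from `0` instead of `1`: the set `{1, …, n}` is `Fin n`, the positive
integers are `ℕ`, the variable `x_{i+1}` is `X i`, the entries of a standard tableau with `n` boxes
are `0, …, n - 1`, and rows and columns are numbered from `0`. The only place where this
matters numerically is the set of descending locations, which is kept in its `1`-based form.

A tableau is given by the list of its rows, from top to bottom (English notation).
-/

namespace StableSpecht

open Equiv

/-! ### The Robinson--Schensted correspondence -/

/-- Row insertion of `x` into a row: `x` replaces the first entry larger than it, which is bumped
and returned, or `x` is put at the end of the row if there is no such entry. -/
def rowInsert (x : ℕ) : List ℕ → List ℕ × Option ℕ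
  | [] => ([x], none)
  | y :: ys =>
    if x < y then (x :: ys, some y)
    else ((y :: (rowInsert x ys).1), (rowInsert x ys).2)

/-- Schensted insertion of `x` into a tableau: the entry bumped from a row is inserted
into the next one. The second component is the index of the row where the new box is created. -/
def insertTab : ℕ → List (List ℕ) → List (List ℕ) × ℕ
  | x, [] => ([[x]], 0)
  | x, r :: rs =>
    match rowInsert x r with
    | (r', none) => (r' :: rs, 0)
    | (r', some y) => (r' :: (insertTab y rs).1, (insertTab y rs).2 + 1)

/-- Add a box with entry `x` at the end of the row of index `k` of a tableau
(which may be the first empty row). -/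
def appendToRow (x : ℕ) : ℕ → List (List ℕ) → List (List ℕ)
  | _, [] => [[x]]
  | 0, r :: rs => (r ++ [x]) :: rs
  | k + 1, r :: rs => r :: appendToRow x k rs

/-- One step of the algorithm on a pair `(P, Q)`, with the value `x` being inserted at time `k`. -/
def rskStep (PQ : List (List ℕ) × List (List ℕ)) (kx : ℕ × ℕ) :
    List (List ℕ) × List (List ℕ) :=
  ((insertTab kx.2 PQ.1).1, appendToRow kx.1 (insertTab kx.2 PQ.1).2 PQ.2)

/-- The pair `(P, Q)` of tableaux attached to a word, starting from two empty tableaux. -/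
def rskWord (l : List ℕ) : List (List ℕ) × List (List ℕ) :=
  (l.zipIdx.map Prod.swap).foldl rskStep ([], [])

/-- The one-line notation of a permutation. -/
def oneLine {n : ℕ} (w : Perm (Fin n)) : List ℕ := List.ofFn fun i => (w i : ℕ)

/-- The insertion tableau `P(w)`. -/
def tabP {n : ℕ} (w : Perm (Fin n)) : List (List ℕ) := (rskWord (oneLine w)).1

/-- The recording tableau `Q(w)`. -/
def tabQ {n : ℕ} (w : Perm (Fin n)) : List (List ℕ) := (rskWord (oneLine w)).2

/-! ### Schützenberger evacuation -/

/-- The part of a jeu de taquin slide that takes place in one row. The first list consists of the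
entries of the row to the right of the hole, and the second one of the entries of the next row
from the box below the hole on. As long as the right neighbour of the hole is smaller than the
one below, it moves to the left; when the neighbour below the hole is smaller (or is the only
neighbour) it moves up. Returns the new contents of the row from the original place of the hole
on, together with the number of steps to the right made before moving down, or `none` if the
hole leaves the tableau through the end of this row. -/
def slideRow : List ℕ → List ℕ → List ℕ × Option ℕ
  | r, [] => (r, none)
  | [], b :: _ => ([b], some 0)
  | a :: r, b :: bs =>
    if a < b then (a :: (slideRow r bs).1, (slideRow r bs).2.map (· + 1))
    else (b :: a :: r, some 0)

/-- The jeu de taquin slide in a tableau with a hole at the box `(0, j)` (the entry that the list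
has in that box is erased). The second component is the index of the row of the box which
is vacated at the end of the slide. -/
def slideTab : ℕ → List (List ℕ) → List (List ℕ) × ℕ
  | _, [] => ([], 0)
  | j, r :: rs =>
    match slideRow (r.drop (j + 1)) ((rs.headD []).drop j) with
    | (r', none) => ((r.take j ++ r') :: rs, 0)
    | (r', some k) => ((r.take j ++ r') :: (slideTab (j + k) rs).1, (slideTab (j + k) rs).2 + 1)

/-- Evacuation of a tableau with `m` boxes: the minimal entry, in the upper left box, is erased,
the resulting hole is slid out of the tableau, the vacated box gets the largest entry
(i.e. `m - 1`), and one continues in the same manner with the remaining tableau. -/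
def evac : ℕ → List (List ℕ) → List (List ℕ)
  | 0, _ => []
  | m + 1, S => appendToRow m (slideTab 0 S).2 (evac m (slideTab 0 S).1)

/-- The tableau `Q̃(w) = ev Q(w)` of the modified correspondence. -/
def tabQt {n : ℕ} (w : Perm (Fin n)) : List (List ℕ) := evac n (tabQ w)

/-! ### Cocharge tableaux -/

/-- The row of `T` in which `i` shows up. -/
def rowOf (T : List (List ℕ)) (i : ℕ) : ℕ := T.findIdx fun r => decide (i ∈ r)

/-- The column of `T` in which `i` shows up. -/
def colOf (T : List (List ℕ)) (i : ℕ) : ℕ := (T.getD (rowOf T i) []).idxOf i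

/-- The entry in the box `(i, j)`. -/
def entry (T : List (List ℕ)) (i j : ℕ) : ℕ := (T.getD i []).getD j 0

/-- The number of boxes. -/
def numBoxes (T : List (List ℕ)) : ℕ := (T.map List.length).sum

/-- The length of the column of index `j`. -/
def colLen (T : List (List ℕ)) (j : ℕ) : ℕ := T.countP fun r => decide (j < r.length)

/-- The descending indices `i` of a standard tableau `S`: the next entry `i + 1` is in a lower row,
weakly to the left. -/
def dsi (S : List (List ℕ)) : Finset ℕ :=
  (Finset.range (numBoxes S - 1)).filter fun i =>
    rowOf S i < rowOf S (i + 1) ∧ colOf S (i + 1) ≤ colOf S i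

/-- The cocharge tableau `ct(S)`: each entry `p` of `S` is replaced by the number of
descending indices of `S` that are smaller than `p`. -/
def ct (S : List (List ℕ)) : List (List ℕ) :=
  S.map fun r => r.map fun p => ((dsi S).filter (· < p)).card

/-! ### Row groups, column groups, and the extended column group -/

/-- The group `R(T)` of permutations preserving the rows of `T`. -/
def rowGroup (n : ℕ) (T : List (List ℕ)) : Subgroup (Perm (Fin n)) where
  carrier := {σ | ∀ p, rowOf T (σ p) = rowOf T p}
  one_mem' := fun _ => rfl
  mul_mem' := fun {a b} ha hb p => (ha (b p)).trans (hb p)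
  inv_mem' := fun {a} ha p => by
    have h := ha (a⁻¹ p)
    rw [show a (a⁻¹ p) = p by simp] at h
    exact h.symm

/-- The group `C(T)` of permutations preserving the columns of `T`. -/
def colGroup (n : ℕ) (T : List (List ℕ)) : Subgroup (Perm (Fin n)) where
  carrier := {σ | ∀ p, colOf T (σ p) = colOf T p}
  one_mem' := fun _ => rfl
  mul_mem' := fun {a b} ha hb p => (ha (b p)).trans (hb p)
  inv_mem' := fun {a} ha p => by
    have h := ha (a⁻¹ p)
    rw [show a (a⁻¹ p) = p by simp] at h
    exact h.symm

/-- The group of the permutations that interchange whole columns of `T` of the same length: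
they are induced by the permutations `η` of the indices of the columns that preserve the
column lengths, and take the entry in row `i` and column `j` to the one in row `i` and
column `η j`. -/
def colPermGroup (n : ℕ) (T : List (List ℕ)) : Subgroup (Perm (Fin n)) where
  carrier := {σ | ∃ η : Perm ℕ, (∀ j, colLen T (η j) = colLen T j) ∧
    ∀ p, rowOf T (σ p) = rowOf T p ∧ colOf T (σ p) = η (colOf T p)}
  one_mem' := ⟨1, fun _ => rfl, fun _ => ⟨rfl, rfl⟩⟩
  mul_mem' := by
    rintro a b ⟨η, h1, h2⟩ ⟨θ, h3, h4⟩
    refine ⟨η * θ, fun j => (h1 (θ j)).trans (h3 j), fun p => ⟨?_, ?_⟩⟩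
    · exact ((h2 (b p)).1).trans (h4 p).1
    · rw [Perm.mul_apply, (h2 (b p)).2, (h4 p).2, Perm.mul_apply]
  inv_mem' := by
    rintro a ⟨η, h1, h2⟩
    refine ⟨η⁻¹, fun j => ?_, fun p => ?_⟩
    · have h := h1 (η⁻¹ j)
      rw [show η (η⁻¹ j) = j by simp] at h
      exact h.symm
    · have h := h2 (a⁻¹ p)
      rw [show a (a⁻¹ p) = p by simp] at h
      exact ⟨h.1.symm, by rw [h.2]; simp⟩

/-- The extended column group `C̃(T)`. -/
def extColGroup (n : ℕ) (T : List (List ℕ)) : Subgroup (Perm (Fin n)) :=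
  colPermGroup n T ⊔ colGroup n T

/-- `χ` is the character of `C̃(T)` that takes the permutations of whole columns
to `1` and the elements of `C(T)` to their signs. (It is unique, since these elements
generate the group.) -/
def IsExtSign {n : ℕ} {T : List (List ℕ)} (χ : extColGroup n T →* ℤˣ) : Prop :=
  (∀ g : extColGroup n T, (g : Perm (Fin n)) ∈ colPermGroup n T → χ g = 1) ∧
  (∀ g : extColGroup n T, (g : Perm (Fin n)) ∈ colGroup n T → χ g = Perm.sign (g : Perm (Fin n)))

/-! ### Higher Specht polynomials -/

open scoped Classical in
/-- The action of the Young symmetrizer `ε_T = ∑_{σ ∈ C(T)} ∑_{τ ∈ R(T)} sgn(σ) σ τ`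
on polynomials, where permutations act by `x_i ↦ x_{σ(i)}`. -/
noncomputable def youngSymm (n : ℕ) (T : List (List ℕ)) (p : MvPolynomial (Fin n) ℚ) :
    MvPolynomial (Fin n) ℚ :=
  ∑ σ : colGroup n T, ∑ τ : rowGroup n T,
    ((Perm.sign (σ : Perm (Fin n)) : ℤ) : ℚ) •
      MvPolynomial.rename ((σ : Perm (Fin n)) * (τ : Perm (Fin n))) p

/-- The monomial `p_T^S`: the exponent of `x_i` is the entry of `ct(S)` in the box of `T`
that contains `i`. -/
noncomputable def spechtMonomial (n : ℕ) (T S : List (List ℕ)) : MvPolynomial (Fin n) ℚ :=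
  ∏ i : Fin n, MvPolynomial.X i ^ entry (ct S) (rowOf T i) (colOf T i)

/-- The size `s_T^S` of the stabilizer of `p_T^S` in `R(T)`. -/
noncomputable def stabSize (n : ℕ) (T S : List (List ℕ)) : ℕ :=
  Nat.card {τ : rowGroup n T //
    MvPolynomial.rename (τ : Perm (Fin n)) (spechtMonomial n T S) = spechtMonomial n T S}

/-- The higher Specht polynomial `F_T^S = ε_T p_T^S / s_T^S`. -/
noncomputable def higherSpecht (n : ℕ) (T S : List (List ℕ)) : MvPolynomial (Fin n) ℚ :=
  ((stabSize n T S : ℚ)⁻¹) • youngSymm n T (spechtMonomial n T S)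

/-- The higher Specht polynomial `F_w` of `w ∈ S_n`, with `T = P(w)` and `S = ev Q(w)`. -/
noncomputable def spechtPoly {n : ℕ} (w : Perm (Fin n)) : MvPolynomial (Fin n) ℚ :=
  higherSpecht n (tabP w) (tabQt w)

/-! ### The infinite symmetric group -/

/-- The embedding of `S_n` into the permutations of `ℕ`, all the numbers outside `Fin n`
being fixed. -/
def embPerm (n : ℕ) : Perm (Fin n) →* Perm ℕ := Perm.extendDomainHom Fin.equivSubtype

/-- The group `S_∞`, the union of the images of all the groups `S_n`: see `mem_SInf_iff`. -/
def SInf : Subgroup (Perm ℕ) where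
  carrier := {σ | ∃ n, ∀ i, n ≤ i → σ i = i}
  one_mem' := ⟨0, fun _ _ => rfl⟩
  mul_mem' := by
    rintro a b ⟨n, hn⟩ ⟨m, hm⟩
    refine ⟨max n m, fun i hi => ?_⟩
    rw [Perm.mul_apply, hm i (le_of_max_le_right hi), hn i (le_of_max_le_left hi)]
  inv_mem' := by
    rintro a ⟨n, hn⟩
    refine ⟨n, fun i hi => ?_⟩
    rw [Perm.inv_eq_iff_eq]
    exact (hn i hi).symm

theorem mem_SInf_iff (σ : Perm ℕ) : σ ∈ SInf ↔ ∃ n, ∃ w : Perm (Fin n), embPerm n w = σ := by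
  constructor
  · rintro ⟨n, hn⟩
    have hlt : ∀ i, i < n ↔ σ i < n := by
      intro i
      constructor
      · intro hi
        by_contra h
        have h2 := σ.injective (hn (σ i) (not_lt.mp h))
        omega
      · intro hi
        by_contra h
        have h2 := hn i (not_lt.mp h)
        omega
    refine ⟨n, Fin.equivSubtype.symm.permCongr (σ.subtypePerm (fun i => (hlt i).symm)), ?_⟩
    ext i
    by_cases hi : i < n
    · have h := Perm.extendDomain_apply_subtype
        (Fin.equivSubtype.symm.permCongr (σ.subtypePerm (fun i => (hlt i).symm)))
        (Fin.equivSubtype (n := n)) hi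
      exact h.trans (by simp [Equiv.permCongr_apply])
    · have h := Perm.extendDomain_apply_not_subtype
        (Fin.equivSubtype.symm.permCongr (σ.subtypePerm (fun i => (hlt i).symm)))
        (Fin.equivSubtype (n := n)) hi
      exact h.trans (hn i (not_lt.mp hi)).symm
  · rintro ⟨n, w, rfl⟩
    exact ⟨n, fun i hi => Perm.extendDomain_apply_not_subtype w Fin.equivSubtype (not_lt.mpr hi)⟩

theorem dslSet_finite (w : SInf) :
    {i : ℕ | ∃ j, i = j + 1 ∧ (w : Perm ℕ) (j + 1) < (w : Perm ℕ) j}.Finite := by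
  obtain ⟨n, hn⟩ := w.2
  refine (Set.finite_Iio (n + 1)).subset ?_
  rintro i ⟨j, rfl, hj⟩
  by_contra h
  have h1 : n ≤ j := by simpa using h
  rw [hn j h1, hn (j + 1) (by omega)] at hj
  omega

/-- The set `Dsl(w)` of descending locations, in the usual numbering from `1`: the integer
`j + 1` is in `Dsl(w)` if the entry in the `(j + 2)`-nd place of the one-line notation, which is
the place of index `j + 1` when counting from `0`, is smaller than the preceding one. -/
noncomputable def dsl (w : SInf) : Finset ℕ := (dslSet_finite w).toFinset

/-! ### Power series in infinitely many variables -/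

/-- The action of a permutation of `ℕ` on power series, by `x_i ↦ x_{σ(i)}`. -/
noncomputable def permAct (σ : Perm ℕ) (F : MvPowerSeries ℕ ℚ) : MvPowerSeries ℕ ℚ :=
  MvPowerSeries.renameEquiv ℚ σ F

/-- Substituting `0` for all the variables except for the first `n` ones. -/
noncomputable def truncVars (n : ℕ) (F : MvPowerSeries ℕ ℚ) : MvPowerSeries (Fin n) ℚ :=
  MvPowerSeries.killCompl Fin.valEmbedding F

end StableSpecht

open StableSpecht

/-!
The series is written down explicitly. For `u ∈ S_n` extend the first row of `T = P(u)` by all the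
variables which are not in `T`, take the sum of all the monomials in which the non-zero exponents
in every row form the same multiset as in the corresponding row of the cocharge tableau of `ev Q(u)`,
and antisymmetrize it with respect to the column group `C(T)`. The result is `stableSeries u`.

The truncation to `n` variables is the higher Specht polynomial because of the orbit-stabilizer
theorem for the row group (`sum_rowGroup`, `truncVars_stableSeries`). Replacing `n` by `n + 1`
appends `n` to the first row of `P(u)` and a box to the first row of `Q(u)`; evacuation turns the
latter into a new first box of the first row, which has cocharge `0` and shifts all other cocharges.
Hence neither the column group nor the non-zero exponents change (`stableSeries_eq`). Permutations of
the variables outside `T` and permutations of whole columns preserve the extended rows and normalize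
the column group, which gives the invariance and the action of the extended column group
(`permAct_of_fixes`, `exists_extSign`); the extended sign exists since the column group is normalized
by the column permutations and meets them trivially (`exists_hom_sup`). Uniqueness holds because a
monomial of degree `d` involves at most `d` variables, so that a finite permutation fixing the first
`m` indices moves it into the first `m + d` variables (`eq_of_truncVars_eq`).

The degree requires that the descents of `ev Q(u)` are those of `u` in reverse order. A standard
tableau is encoded by the lattice word of the rows of its entries. On such words a jeu de taquin
slide is given by a local rule (`localStep`) which lets a hole pass an entry, and this rule preserves
the relative position both of two consecutive entries passed by one hole and of two consecutive
holes passing one entry. The first fact shows that slides preserve descents, the second one that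
evacuation reverses them (`desc_evacWord`). The row bumping lemma shows that `Q(u)` has its descents
where `u` has (`desc_recRows`), and column-strictness of the insertion tableau that its shapes are
partitions (`recRows_latt`).
-/

namespace StableSpecht

open Equiv

/-! ### Lattice words -/

/-- The shape obtained from the shape with row lengths `μ` by adding a box in row `b`. -/
def addBox (μ : ℕ → ℕ) (b : ℕ) : ℕ → ℕ := fun i => μ i + if i = b then 1 else 0

/-- A box can be added to the shape `μ` at the end of row `b`. -/
def Addable (μ : ℕ → ℕ) (b : ℕ) : Prop := ∀ c, b = c + 1 → μ b < μ c

/-- The letters of `l` are the rows of boxes that can be added one by one to the shape `μ`. -/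
def Latt : (ℕ → ℕ) → List ℕ → Prop
  | _, [] => True
  | μ, b :: l => Addable μ b ∧ Latt (addBox μ b) l

/-- The shape obtained by adding boxes in the rows listed in `l`. -/
def addBoxes (μ : ℕ → ℕ) (l : List ℕ) : ℕ → ℕ := fun i => μ i + l.count i

@[simp] lemma addBoxes_nil (μ : ℕ → ℕ) : addBoxes μ [] = μ := by
  funext i
  simp [addBoxes]

lemma addBoxes_cons (μ : ℕ → ℕ) (b : ℕ) (l : List ℕ) :
    addBoxes μ (b :: l) = addBoxes (addBox μ b) l := by
  funext i
  simp only [addBoxes, addBox, List.count_cons, beq_iff_eq]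
  grind

lemma addBoxes_append (μ : ℕ → ℕ) (l l' : List ℕ) :
    addBoxes μ (l ++ l') = addBoxes (addBoxes μ l) l' := by
  funext i
  simp only [addBoxes, List.count_append]
  omega

lemma addBox_antitone {μ : ℕ → ℕ} {b : ℕ} (hμ : Antitone μ) (hb : Addable μ b) :
    Antitone (addBox μ b) := by
  refine antitone_nat_of_succ_le fun i => ?_
  have h1 := hμ (Nat.le_succ i)
  have h2 := hb i
  simp only [addBox]
  grind

lemma latt_append {μ : ℕ → ℕ} {l l' : List ℕ} :
    Latt μ (l ++ l') ↔ Latt μ l ∧ Latt (addBoxes μ l) l' := by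
  induction l generalizing μ with
  | nil => simp [Latt]
  | cons b l ih => simp [Latt, ih, addBoxes_cons, and_assoc]

lemma addBoxes_antitone {μ : ℕ → ℕ} {l : List ℕ} (hμ : Antitone μ) (hl : Latt μ l) :
    Antitone (addBoxes μ l) := by
  induction l generalizing μ with
  | nil => simpa using hμ
  | cons b l ih =>
    rw [addBoxes_cons]
    exact ih (addBox_antitone hμ hl.1) hl.2

/-! ### Promotion and evacuation of lattice words -/

/-- The jeu de taquin slide in terms of the rows of the entries: the hole is at the end of row `a`
of the shape `addBox μ a`, and the entries still to be processed lie in the rows `l`. An entry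
directly below the hole moves up and the hole takes its place; any other entry keeps its row.
The second component is the final row of the hole. -/
def slideWord : (ℕ → ℕ) → ℕ → List ℕ → List ℕ × ℕ
  | _, a, [] => ([], a)
  | μ, a, b :: l =>
    if b = a + 1 ∧ μ b = μ a then
      (a :: (slideWord (addBox μ a) (a + 1) l).1, (slideWord (addBox μ a) (a + 1) l).2)
    else (b :: (slideWord (addBox μ b) a l).1, (slideWord (addBox μ b) a l).2)

/-- Evacuation in terms of the rows of the entries. -/
def evacWord : ℕ → List ℕ → List ℕ
  | 0, _ => []
  | _ + 1, [] => []
  | m + 1, _ :: l => evacWord m (slideWord 0 0 l).1 ++ [(slideWord 0 0 l).2]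

/-- The descents of a word in the letters `0, 1, …` denoting rows: consecutive places where
the second letter is larger, i.e. denotes a lower row. -/
def desc : List ℕ → List Bool
  | [] => []
  | [_] => []
  | a :: b :: l => decide (a < b) :: desc (b :: l)

/-- The row of the processed entry, and the new row of the hole. -/
def localStep (μ : ℕ → ℕ) (a b : ℕ) : ℕ × ℕ :=
  if b = a + 1 ∧ μ b = μ a then (a, a + 1) else (b, a)

lemma slideWord_cons (μ : ℕ → ℕ) (a b : ℕ) (l : List ℕ) :
    slideWord μ a (b :: l) =
      ((localStep μ a b).1 :: (slideWord (addBox μ (localStep μ a b).1) (localStep μ a b).2 l).1,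
        (slideWord (addBox μ (localStep μ a b).1) (localStep μ a b).2 l).2) := by
  simp only [slideWord, localStep]
  split_ifs <;> rfl

lemma addBox_comm (μ : ℕ → ℕ) (a b : ℕ) : addBox (addBox μ a) b = addBox (addBox μ b) a := by
  funext i
  simp only [addBox]
  omega

lemma localStep_addBox (μ : ℕ → ℕ) (a b : ℕ) :
    addBox (addBox μ (localStep μ a b).1) (localStep μ a b).2 = addBox (addBox μ a) b := by
  simp only [localStep]
  split_ifs with h
  · simp [h.1]
  · exact addBox_comm _ _ _

lemma localStep_fst_addable {μ : ℕ → ℕ} {a b : ℕ} (hμ : Antitone μ) (ha : Addable μ a)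
    (hb : Addable (addBox μ a) b) : Addable μ (localStep μ a b).1 := by
  simp only [localStep]
  split_ifs with h
  · exact ha
  · intro c hc
    have h1 := hb c hc
    have h2 := hμ (show c ≤ b by omega)
    simp only [addBox] at h1
    grind

lemma localStep_snd_addable {μ : ℕ → ℕ} {a b : ℕ} (ha : Addable μ a)
    (hb : Addable (addBox μ a) b) :
    Addable (addBox μ (localStep μ a b).1) (localStep μ a b).2 := by
  intro c hc
  simp only [localStep] at hc ⊢
  have h3 := ha c
  have h1 := hb c
  simp only [addBox] at *
  split_ifs at hc ⊢ <;> grind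

/-- Two consecutive entries passed by a hole keep their relative position. -/
lemma localStep_desc {μ : ℕ → ℕ} {a b c : ℕ} (hμ : Antitone μ)
    (hb : Addable (addBox μ a) b) (hc : Addable (addBox (addBox μ a) b) c) :
    (localStep μ a b).1 < (localStep (addBox μ (localStep μ a b).1) (localStep μ a b).2 c).1
      ↔ b < c := by
  have h1 := hb a
  have h2 := hc a
  have h3 := hc (a + 1)
  have h4 := hμ (show a ≤ a + 1 by omega)
  simp only [localStep, addBox] at *
  grind

/-- Two holes passing an entry one after the other keep their relative position. -/
lemma localStep_holes {μ : ℕ → ℕ} {a a' b : ℕ} (hμ : Antitone μ) (ha' : Addable μ a')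
    (ha : Addable (addBox μ a') a) (hb : Addable (addBox (addBox μ a') a) b) :
    (localStep μ a' (localStep (addBox μ a') a b).1).2 < (localStep (addBox μ a') a b).2
      ↔ a' < a := by
  have h1 := ha a'
  have h2 := hb a
  have h3 := hb a'
  have h4 := hμ (show a' ≤ a' + 1 by omega)
  have h5 := hμ (show a ≤ a + 1 by omega)
  have h6 := ha' a
  simp only [localStep, addBox] at *
  grind

lemma slideWord_length (μ : ℕ → ℕ) (a : ℕ) (l : List ℕ) :
    (slideWord μ a l).1.length = l.length := by
  induction l generalizing μ a with
  | nil => rfl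
  | cons b l ih => rw [slideWord_cons]; simp [ih]

/-- The slide of a lattice word is a lattice word for the shape without the hole. -/
lemma slideWord_latt {μ : ℕ → ℕ} {a : ℕ} {l : List ℕ} (hμ : Antitone μ) (ha : Addable μ a)
    (hl : Latt (addBox μ a) l) : Latt μ (slideWord μ a l).1 := by
  induction l generalizing μ a with
  | nil => trivial
  | cons b l ih =>
    rw [slideWord_cons]
    have h := localStep_fst_addable hμ ha hl.1
    refine ⟨h, ih (addBox_antitone hμ h) (localStep_snd_addable ha hl.1) ?_⟩
    rw [localStep_addBox]
    exact hl.2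

/-- The slide leaves the final shape unchanged: the hole ends up in the box by which it differs
from the shape of the slid word. -/
lemma slideWord_addBoxes (μ : ℕ → ℕ) (a : ℕ) (l : List ℕ) :
    addBox (addBoxes μ (slideWord μ a l).1) (slideWord μ a l).2 = addBoxes μ (a :: l) := by
  induction l generalizing μ a with
  | nil => simp [slideWord, addBoxes_cons]
  | cons b l ih =>
    rw [slideWord_cons, addBoxes_cons, ih, addBoxes_cons, localStep_addBox, addBoxes_cons,
      addBoxes_cons]

/-- Slides preserve descents. -/
lemma slideWord_desc {μ : ℕ → ℕ} {a : ℕ} {l : List ℕ} (hμ : Antitone μ) (ha : Addable μ a)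
    (hl : Latt (addBox μ a) l) : desc (slideWord μ a l).1 = desc l := by
  induction l generalizing μ a with
  | nil => rfl
  | cons b l ih =>
    have h := localStep_fst_addable hμ ha hl.1
    have ih' := ih (addBox_antitone hμ h) (localStep_snd_addable ha hl.1)
      (by rw [localStep_addBox]; exact hl.2)
    rw [slideWord_cons]
    cases l with
    | nil => rfl
    | cons c l =>
      rw [slideWord_cons] at ih' ⊢
      simp only [desc, ih', List.cons.injEq, and_true, decide_eq_decide]
      exact localStep_desc hμ hl.1 hl.2.1

/-- The final holes of two consecutive slides are in the same relative position as the two holes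
at the start. -/
lemma slideWord_holes {μ : ℕ → ℕ} {a a' : ℕ} {l : List ℕ} (hμ : Antitone μ) (ha' : Addable μ a')
    (ha : Addable (addBox μ a') a) (hl : Latt (addBox (addBox μ a') a) l) :
    (slideWord μ a' (slideWord (addBox μ a') a l).1).2 < (slideWord (addBox μ a') a l).2
      ↔ a' < a := by
  induction l generalizing μ a a' with
  | nil => rfl
  | cons b l ih =>
    have hμ' := addBox_antitone hμ ha'
    have h1 := localStep_fst_addable hμ' ha hl.1
    have h2 := localStep_snd_addable ha hl.1
    have h3 := localStep_fst_addable hμ ha' h1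
    have h4 := localStep_snd_addable ha' h1
    rw [slideWord_cons (addBox μ a') a b, slideWord_cons μ a', ← localStep_holes hμ ha' ha hl.1]
    have h5 := localStep_addBox μ a' (localStep (addBox μ a') a b).1
    simp only
    rw [← h5] at h2 ⊢
    refine ih (addBox_antitone hμ h3) h4 h2 ?_
    rw [h5, localStep_addBox]
    exact hl.2

lemma zero_antitone : Antitone (0 : ℕ → ℕ) := fun _ _ _ => le_rfl

lemma zero_addable (μ : ℕ → ℕ) : Addable μ 0 := fun _ h => by omega

lemma latt_zero_cons {b : ℕ} {l : List ℕ} (h : Latt 0 (b :: l)) : b = 0 := by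
  by_contra hb
  have := h.1 (b - 1) (by omega)
  simp at this

lemma evacWord_length (l : List ℕ) : (evacWord l.length l).length = l.length := by
  suffices ∀ m (l : List ℕ), l.length = m → (evacWord m l).length = m from this _ l rfl
  intro m
  induction m with
  | zero => intros; rfl
  | succ m ih =>
    rintro (_ | ⟨b, l⟩) h
    · simp at h
    · simp only [evacWord, List.length_append, List.length_singleton, Nat.add_right_cancel_iff]
      exact ih _ (by simpa [slideWord_length] using h)

/-- A first-row box added at the end is the first one in the evacuated word. -/
lemma evacWord_concat_zero (l : List ℕ) :
    evacWord (l.length + 1) (l ++ [0]) = 0 :: evacWord l.length l := by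
  have key (μ : ℕ → ℕ) (a : ℕ) (l : List ℕ) :
      slideWord μ a (l ++ [0]) = ((slideWord μ a l).1 ++ [0], (slideWord μ a l).2) := by
    induction l generalizing μ a with
    | nil => simp [slideWord]
    | cons b l ih => rw [List.cons_append, slideWord_cons, slideWord_cons, ih]; rfl
  suffices ∀ m (l : List ℕ), l.length = m →
      evacWord (m + 1) (l ++ [0]) = 0 :: evacWord m l from this _ l rfl
  intro m
  induction m with
  | zero => intro l hl; rw [List.length_eq_zero_iff.mp hl]; rfl
  | succ m ih =>
    rintro (_ | ⟨b, l⟩) h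
    · simp at h
    · rw [List.cons_append, evacWord, key, ih _ (by simpa [slideWord_length] using h)]
      rfl

/-- Evacuation preserves the shape. -/
lemma evacWord_count {l : List ℕ} (hl : Latt 0 l) (i : ℕ) :
    (evacWord l.length l).count i = l.count i := by
  suffices ∀ m (l : List ℕ), l.length = m → Latt 0 l →
      (evacWord m l).count i = l.count i from this _ l rfl hl
  intro m
  induction m with
  | zero => intro l hl _; rw [List.length_eq_zero_iff.mp hl]; rfl
  | succ m ih =>
    rintro (_ | ⟨b, l⟩) h hl
    · simp at h
    · obtain rfl := latt_zero_cons hl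
      have h1 := congrFun (slideWord_addBoxes 0 0 l) i
      rw [evacWord, List.count_append, ih _ (by simpa [slideWord_length] using h)
        (slideWord_latt zero_antitone (zero_addable _) hl.2)]
      simp only [addBox, addBoxes, Pi.zero_apply, zero_add] at h1
      rw [← h1, List.count_singleton]
      grind

/-- The prefixes of the evacuated word have the shapes of the successively slid words, hence it is
a lattice word. -/
lemma evacWord_latt {l : List ℕ} (hl : Latt 0 l) : Latt 0 (evacWord l.length l) := by
  suffices ∀ m (l : List ℕ), l.length = m → Latt 0 l → Latt 0 (evacWord m l) from this _ l rfl hl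
  intro m
  induction m with
  | zero => intros; trivial
  | succ m ih =>
    rintro (_ | ⟨b, l⟩) h hl
    · simp at h
    · obtain rfl := latt_zero_cons hl
      have h0 := slideWord_latt zero_antitone (zero_addable _) hl.2
      have hlen : (slideWord 0 0 l).1.length = m := by simpa [slideWord_length] using h
      rw [evacWord, latt_append]
      refine ⟨ih _ hlen h0, ?_, trivial⟩
      have h1 := slideWord_addBoxes 0 0 l
      have h2 := addBoxes_antitone zero_antitone hl
      have h3 : addBoxes 0 (evacWord m (slideWord 0 0 l).1) = addBoxes 0 (slideWord 0 0 l).1 := by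
        funext i
        simp only [addBoxes]
        rw [← hlen, evacWord_count h0]
      rw [h3]
      intro c hc
      have h4 := h2 (show c ≤ c + 1 by omega)
      rw [← h1] at h4
      simp only [addBox] at h4
      grind

lemma desc_concat (l : List ℕ) (a b : ℕ) :
    desc (l ++ [a, b]) = desc (l ++ [a]) ++ [decide (a < b)] := by
  induction l with
  | nil => rfl
  | cons c l ih =>
    cases l with
    | nil => rfl
    | cons d l => simpa [desc] using ih

/-- Evacuation reverses the sequence of descents. -/
theorem desc_evacWord {l : List ℕ} (hl : Latt 0 l) :
    desc (evacWord l.length l) = (desc l).reverse := by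
  suffices ∀ m (l : List ℕ), l.length = m → Latt 0 l →
      desc (evacWord m l) = (desc l).reverse from this _ l rfl hl
  intro m
  induction m with
  | zero => intro l hl _; rw [List.length_eq_zero_iff.mp hl]; rfl
  | succ m ih =>
    rintro (_ | ⟨b, l⟩) h hl
    · simp at h
    obtain rfl := latt_zero_cons hl
    cases l with
    | nil =>
      obtain rfl : m = 0 := by simpa using h.symm
      rfl
    | cons c l =>
      obtain ⟨m, rfl⟩ : ∃ k, m = k + 1 := ⟨l.length, by simpa using h.symm⟩
      have h0 := slideWord_latt zero_antitone (zero_addable _) hl.2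
      have hd := slideWord_desc zero_antitone (zero_addable _) hl.2
      have ih' := ih _ (by simpa [slideWord_length] using h) h0
      rw [evacWord]
      have hA := localStep_addBox 0 0 c
      have hs := localStep_snd_addable (zero_addable _) hl.2.1
      rw [slideWord_cons] at h0 hd ih' ⊢
      have hz := latt_zero_cons h0
      rw [hz] at hA hs hd ih' ⊢
      simp only [evacWord] at ih' ⊢
      rw [List.append_assoc, List.cons_append, List.nil_append, desc_concat, ih', hd]
      have key := slideWord_holes (l := l) zero_antitone (zero_addable _) hs
        (by rw [hA]; exact hl.2.2)
      rw [desc, List.reverse_cons]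
      congr 2
      rw [decide_eq_decide, key]
      have := hl.2.1
      simp only [localStep] at hz ⊢
      simp only [Pi.zero_apply] at hz ⊢
      grind

/-! ### Tableaux as lists of rows -/

/-- The length of row `i`, zero below the last row. -/
def rowLen (T : List (List ℕ)) (i : ℕ) : ℕ := (T.getD i []).length

/-- Boxes with the entries `s, s + 1, …` are added to `T`, in the rows listed in the word. -/
def tabFrom : List (List ℕ) → ℕ → List ℕ → List (List ℕ)
  | T, _, [] => T
  | T, s, b :: l => tabFrom (appendToRow s b T) (s + 1) l

/-- The entries of `T` are `0, …, n - 1`, each occurring once. -/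
def IsFilling (n : ℕ) (T : List (List ℕ)) : Prop := T.flatten.Perm (List.range n)

lemma getD_appendToRow (x : ℕ) {k : ℕ} {T : List (List ℕ)} (h : k ≤ T.length) (i : ℕ) :
    (appendToRow x k T).getD i [] = T.getD i [] ++ if i = k then [x] else [] := by
  induction T generalizing k i with
  | nil =>
    obtain rfl : k = 0 := by simpa using h
    cases i <;> simp [appendToRow]
  | cons r rs ih =>
    cases k with
    | zero => cases i <;> simp [appendToRow]
    | succ k =>
      cases i with
      | zero => simp [appendToRow]
      | succ i => simpa [appendToRow] using ih (by simpa using h) i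

lemma rowLen_appendToRow (x : ℕ) {k : ℕ} {T : List (List ℕ)} (h : k ≤ T.length) :
    rowLen (appendToRow x k T) = addBox (rowLen T) k := by
  funext i
  rw [rowLen, getD_appendToRow x h, addBox, rowLen, List.length_append]
  split_ifs <;> rfl

lemma length_appendToRow (x : ℕ) {k : ℕ} {T : List (List ℕ)} (h : k < T.length) :
    (appendToRow x k T).length = T.length := by
  induction T generalizing k with
  | nil => simp at h
  | cons r rs ih =>
    cases k with
    | zero => rfl
    | succ k => simpa [appendToRow] using ih (by simpa using h)

lemma flatten_appendToRow (x k : ℕ) (T : List (List ℕ)) :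
    (appendToRow x k T).flatten.Perm (x :: T.flatten) := by
  induction T generalizing k with
  | nil => simp [appendToRow]
  | cons r rs ih =>
    cases k with
    | zero => simp [appendToRow, List.perm_middle]
    | succ k => simpa [appendToRow] using ((ih k).append_left r).trans List.perm_middle

lemma mem_appendToRow {x k y : ℕ} {T : List (List ℕ)} :
    y ∈ (appendToRow x k T).flatten ↔ y = x ∨ y ∈ T.flatten := by
  rw [(flatten_appendToRow x k T).mem_iff, List.mem_cons]

/-- Only the first empty row, or a non-empty one, can receive a box. -/
lemma addable_le_length {T : List (List ℕ)} {b : ℕ} (h : Addable (rowLen T) b) :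
    b ≤ T.length := by
  cases b with
  | zero => exact Nat.zero_le _
  | succ b =>
    have h1 := h b rfl
    by_contra h2
    rw [rowLen, rowLen, List.getD_eq_default T [] (by omega : T.length ≤ b)] at h1
    simp at h1

lemma rowLen_pad (T : List (List ℕ)) (k : ℕ) : rowLen (T ++ List.replicate k []) = rowLen T := by
  funext i
  simp only [rowLen, List.getD_eq_getElem?_getD, List.getElem?_append, List.getElem?_replicate]
  grind

lemma tabFrom_concat (T : List (List ℕ)) (s b : ℕ) (l : List ℕ) :
    tabFrom T s (l ++ [b]) = appendToRow (s + l.length) b (tabFrom T s l) := by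
  induction l generalizing T s with
  | nil => rfl
  | cons c l ih => simp [tabFrom, ih, Nat.add_comm, Nat.add_left_comm]

/-! ### Slides and evacuation in terms of lattice words -/

lemma slideRow_concat_left {x : ℕ} {r s : List ℕ} (h : ∀ y ∈ s, y < x) :
    slideRow (r ++ [x]) s = ((slideRow r s).1 ++ [x], (slideRow r s).2) := by
  induction r generalizing s with
  | nil =>
    cases s with
    | nil => rfl
    | cons b s =>
      have := h b (by simp)
      simp [slideRow, Nat.not_lt.mpr this.le]
  | cons a r ih =>
    cases s with
    | nil => simp [slideRow]
    | cons b s =>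
      simp only [List.cons_append, slideRow]
      split_ifs
      · rw [ih fun y hy => h y (by simp [hy])]
        rfl
      · rfl

/-- A largest entry added at the end of the lower row matters only if the hole would otherwise
leave the upper row and comes to lie directly above this entry. -/
lemma slideRow_concat_right {x : ℕ} {r s : List ℕ} (h : ∀ y ∈ r, y < x)
    (hl : s.length ≤ r.length) :
    slideRow r (s ++ [x]) = if (slideRow r s).2 = none ∧ s.length = r.length then
      (r ++ [x], some r.length) else slideRow r s := by
  induction r generalizing s with
  | nil =>
    obtain rfl : s = [] := by simpa using hl
    simp [slideRow]
  | cons a r ih =>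
    have ha := h a (by simp)
    have h' : ∀ y ∈ r, y < x := fun y hy => h y (by simp [hy])
    cases s with
    | nil => simp [slideRow, ha]
    | cons b s =>
      simp only [List.cons_append, slideRow]
      split_ifs with h1 h2 h2
      · rw [ih h' (by simpa using hl)]
        simp only [List.length_cons, Nat.add_right_cancel_iff, Option.map_eq_none_iff] at h2
        rw [if_pos h2]
        rfl
      · rw [ih h' (by simpa using hl)]
        simp only [List.length_cons, Nat.add_right_cancel_iff, Option.map_eq_none_iff] at h2
        rw [if_neg h2]
      · simp at h2
      · rfl

lemma slideRow_of_none {r s : List ℕ} (h : (slideRow r s).2 = none) : (slideRow r s).1 = r := by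
  induction r generalizing s with
  | nil => cases s <;> simp_all [slideRow]
  | cons a r ih =>
    cases s with
    | nil => rfl
    | cons b s =>
      simp only [slideRow] at h ⊢
      split_ifs with h1
      · simp only [h1, if_true, Option.map_eq_none_iff] at h
        simp [ih h]
      · simp [h1] at h

lemma slideRow_lt {r s : List ℕ} {k : ℕ} (h : (slideRow r s).2 = some k) : k < s.length := by
  induction r generalizing s k with
  | nil => cases s <;> simp_all [slideRow]; omega
  | cons a r ih =>
    cases s with
    | nil => simp [slideRow] at h
    | cons b s =>
      simp only [slideRow] at h
      split_ifs at h with h1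
      · simp only [Option.map_eq_some_iff] at h
        obtain ⟨k, h, rfl⟩ := h
        simpa using ih h
      · simp at h
        simp [← h]

lemma slideTab_cons_none {j : ℕ} {r : List ℕ} {rs : List (List ℕ)}
    (h : (slideRow (r.drop (j + 1)) ((rs.headD []).drop j)).2 = none) :
    slideTab j (r :: rs) = ((r.take j ++ r.drop (j + 1)) :: rs, 0) := by
  have h' := slideRow_of_none h
  rw [slideTab]
  split
  · next h1 => rw [h1] at h'; simp_all
  · next h1 => rw [h1] at h; simp at h

lemma slideTab_cons_some {j k : ℕ} {r : List ℕ} {rs : List (List ℕ)}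
    (h : (slideRow (r.drop (j + 1)) ((rs.headD []).drop j)).2 = some k) :
    slideTab j (r :: rs) =
      ((r.take j ++ (slideRow (r.drop (j + 1)) ((rs.headD []).drop j)).1) ::
        (slideTab (j + k) rs).1, (slideTab (j + k) rs).2 + 1) := by
  rw [slideTab]
  split
  · next h1 => rw [h1] at h; simp at h
  · next h1 => rw [h1] at h ⊢; simp_all

lemma length_slideTab (j : ℕ) (T : List (List ℕ)) : (slideTab j T).1.length = T.length := by
  induction T generalizing j with
  | nil => rfl
  | cons r rs ih =>
    rcases h : (slideRow (r.drop (j + 1)) ((rs.headD []).drop j)).2 with _ | k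
    · rw [slideTab_cons_none h]; rfl
    · rw [slideTab_cons_some h]; simp [ih]

lemma slideTab_snd_lt {j : ℕ} {T : List (List ℕ)} (hT : T ≠ []) :
    (slideTab j T).2 < T.length := by
  induction T generalizing j with
  | nil => simp at hT
  | cons r rs ih =>
    rcases h : (slideRow (r.drop (j + 1)) ((rs.headD []).drop j)).2 with _ | k
    · rw [slideTab_cons_none h]; simp
    · rw [slideTab_cons_some h]
      have : rs ≠ [] := by
        rintro rfl
        have := slideRow_lt h
        simp at this
      simpa using ih this

lemma localStep_rowLen_cons (r : List ℕ) (T : List (List ℕ)) (a b : ℕ) :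
    localStep (rowLen (r :: T)) (a + 1) (b + 1) =
      ((localStep (rowLen T) a b).1 + 1, (localStep (rowLen T) a b).2 + 1) := by
  have h (i : ℕ) : rowLen (r :: T) (i + 1) = rowLen T i := rfl
  simp only [localStep, h, Nat.add_right_cancel_iff]
  split_ifs <;> rfl

/-- The effect of the largest entry on a slide: it is carried along by `localStep`. -/
lemma slideTab_appendToRow {x : ℕ} {T : List (List ℕ)} {j b : ℕ} (hj : j < rowLen T 0)
    (hT : Antitone (rowLen T)) (hx : ∀ y ∈ T.flatten, y < x) (hbl : b < T.length)
    (hb : Addable (rowLen T) b) :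
    slideTab j (appendToRow x b T) =
      (appendToRow x (localStep (rowLen (slideTab j T).1) (slideTab j T).2 b).1 (slideTab j T).1,
        (localStep (rowLen (slideTab j T).1) (slideTab j T).2 b).2) := by
  induction T generalizing j b with
  | nil => simp at hbl
  | cons r rs ih =>
    have hj' : j < r.length := by simpa [rowLen] using hj
    have hxr : ∀ y ∈ r, y < x := fun y hy => hx y (by simp [hy])
    have hxs : ∀ y ∈ rs.flatten, y < x := fun y hy => hx y (by simp [hy])
    have hrs : Antitone (rowLen rs) := fun i k hik => by
      simpa [rowLen] using hT (Nat.succ_le_succ hik)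
    rcases b with _ | b
    · -- the new entry is at the end of the first row
      have h1 : slideRow ((r ++ [x]).drop (j + 1)) ((rs.headD []).drop j) =
          ((slideRow (r.drop (j + 1)) ((rs.headD []).drop j)).1 ++ [x],
            (slideRow (r.drop (j + 1)) ((rs.headD []).drop j)).2) := by
        rw [List.drop_append_of_le_length (by omega), slideRow_concat_left]
        intro y hy
        refine hxs y ?_
        rcases rs with _ | ⟨s, ss⟩
        · simp at hy
        · have := List.mem_of_mem_drop hy
          simp_all
      rcases h : (slideRow (r.drop (j + 1)) ((rs.headD []).drop j)).2 with _ | k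
      · have h2 := h
        rw [show (slideRow _ _).2 = (slideRow ((r ++ [x]).drop (j + 1)) ((rs.headD []).drop j)).2 by
          rw [h1]] at h2
        rw [appendToRow, slideTab_cons_none h2, slideTab_cons_none h]
        simp [localStep, appendToRow, List.drop_append_of_le_length (show j + 1 ≤ r.length by omega),
          List.take_append_of_le_length hj'.le]
      · have h2 := h
        rw [show (slideRow _ _).2 = (slideRow ((r ++ [x]).drop (j + 1)) ((rs.headD []).drop j)).2 by
          rw [h1]] at h2
        rw [appendToRow, slideTab_cons_some h2, slideTab_cons_some h, h1]
        simp [localStep, appendToRow, List.take_append_of_le_length hj'.le]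
    · rcases rs with _ | ⟨s, ss⟩
      · simp at hbl
      have hbs : Addable (rowLen (s :: ss)) b := by
        rintro c rfl
        simpa [rowLen] using hb (c + 1) rfl
      have hbl' : b < (s :: ss).length := by simpa using hbl
      -- what happens if the slide in the first row is not influenced by the new entry
      have same (h0 : (slideRow (r.drop (j + 1)) (s.drop j)).2 = none →
            ¬ (b = 0 ∧ rowLen (s :: ss) 0 = (r.take j ++ r.drop (j + 1)).length))
          (h1 : slideRow (r.drop (j + 1)) (((appendToRow x b (s :: ss)).headD []).drop j) =
            slideRow (r.drop (j + 1)) (s.drop j)) :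
          slideTab j (appendToRow x (b + 1) (r :: s :: ss)) =
            (appendToRow x (localStep (rowLen (slideTab j (r :: s :: ss)).1)
                (slideTab j (r :: s :: ss)).2 (b + 1)).1 (slideTab j (r :: s :: ss)).1,
              (localStep (rowLen (slideTab j (r :: s :: ss)).1)
                (slideTab j (r :: s :: ss)).2 (b + 1)).2) := by
        rcases h : (slideRow (r.drop (j + 1)) (s.drop j)).2 with _ | k
        · rw [appendToRow, slideTab_cons_none (by rw [h1, h]), slideTab_cons_none (by simpa using h)]
          rw [localStep, if_neg]
          · simp [appendToRow]
          · rintro ⟨hb0, hlen⟩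
            obtain rfl : b = 0 := by omega
            exact h0 h ⟨rfl, by simpa [rowLen] using hlen⟩
        · have hk : j + k < rowLen (s :: ss) 0 := by
            have := slideRow_lt h
            simp only [List.length_drop] at this
            simp only [rowLen, List.getD_cons_zero]
            omega
          rw [appendToRow, slideTab_cons_some (by rw [h1, h]), slideTab_cons_some (by simpa using h),
            ih hk hrs hxs hbl' hbs, h1]
          simp only [List.headD_cons, localStep_rowLen_cons, appendToRow]
      rcases b with _ | b
      · -- the new entry is at the end of the second row
        have hlen : s.length < r.length := by simpa [rowLen] using hb 0 rfl
        have hxd : ∀ y ∈ r.drop (j + 1), y < x := fun y hy => hxr y (List.mem_of_mem_drop hy)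
        have hlen' : (r.take j ++ r.drop (j + 1)).length = r.length - 1 := by simp; omega
        by_cases hjs : j ≤ s.length
        · have h1 := slideRow_concat_right (s := s.drop j) hxd (by simp; omega)
          rw [← List.drop_append_of_le_length hjs] at h1
          split_ifs at h1 with h2
          · obtain ⟨h3, h4⟩ := h2
            have h5 : s.length + 1 = r.length := by simp at h4; omega
            have h6 : (slideRow (r.drop (j + 1)) ((((s ++ [x]) :: ss).headD []).drop j)).2 =
              some (s.length - j) := by simp only [List.headD_cons]; rw [h1]; simp; omega
            have h7 : ss.headD [] = [] ∨ (ss.headD []).length ≤ s.length := by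
              have := hrs (show 0 ≤ 1 by omega)
              rcases ss with _ | ⟨t, ss⟩
              · simp
              · right; simpa [rowLen] using this
            have h8 : (ss.headD []).drop s.length = [] := by
              rcases h7 with h7 | h7
              · rw [h7, List.drop_nil]
              · exact List.drop_eq_nil_of_le h7
            have h9 : slideTab (j + (s.length - j)) ((s ++ [x]) :: ss) = (s :: ss, 0) := by
              rw [show j + (s.length - j) = s.length by omega, slideTab_cons_none]
              · simp
              · rw [h8, slideRow]
            rw [appendToRow, appendToRow, slideTab_cons_some h6, h9,
              slideTab_cons_none (by simpa using h3)]
            simp only [List.headD_cons]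
            rw [h1, localStep, if_pos]
            · simp [appendToRow]
            · refine ⟨rfl, ?_⟩
              simp only [rowLen, List.getD_cons_succ, List.getD_cons_zero, hlen']
              omega
          · refine same ?_ (by simpa [appendToRow] using h1)
            rintro h3 ⟨-, h4⟩
            refine h2 ⟨h3, ?_⟩
            rw [hlen'] at h4
            simp [rowLen] at h4 ⊢
            omega
        · refine same ?_ ?_
          · rintro - ⟨-, h4⟩
            rw [hlen'] at h4
            simp [rowLen] at h4
            omega
          · simp only [appendToRow, List.headD_cons]
            rw [List.drop_eq_nil_of_le (as := s ++ [x]) (by simp; omega),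
              List.drop_eq_nil_of_le (as := s) (by omega)]
      · exact same (by simp) (by simp [appendToRow])

/-- The slide of a tableau extended by larger entries, in terms of the rows of these entries. -/
lemma slideTab_tabFrom {T : List (List ℕ)} {s : ℕ} {l : List ℕ} (h0 : 0 < rowLen T 0)
    (hT : Antitone (rowLen T)) (hx : ∀ y ∈ T.flatten, y < s) (hbl : ∀ b ∈ l, b < T.length)
    (hl : Latt (rowLen T) l) :
    slideTab 0 (tabFrom T s l) =
      (tabFrom (slideTab 0 T).1 s (slideWord (rowLen (slideTab 0 T).1) (slideTab 0 T).2 l).1,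
        (slideWord (rowLen (slideTab 0 T).1) (slideTab 0 T).2 l).2) := by
  induction l generalizing T s with
  | nil => rfl
  | cons b l ih =>
    have hb : b < T.length := hbl b (by simp)
    have hr := rowLen_appendToRow s hb.le
    rw [tabFrom, ih, slideTab_appendToRow h0 hT hx hb hl.1, slideWord_cons]
    · have hlt : (slideTab 0 T).2 < T.length := slideTab_snd_lt (by rintro rfl; simp at hb)
      rw [rowLen_appendToRow, tabFrom]
      rw [length_slideTab, localStep]
      split_ifs <;> simp only <;> omega
    · rw [hr]; simp only [addBox]; omega
    · rw [hr]; exact addBox_antitone hT hl.1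
    · intro y hy
      rcases mem_appendToRow.mp hy with rfl | hy
      · omega
      · have := hx y hy; omega
    · intro c hc
      rw [length_appendToRow s hb]
      exact hbl c (by simp [hc])
    · rw [hr]; exact hl.2

lemma slideTab_pad (j : ℕ) (T : List (List ℕ)) (k : ℕ) :
    slideTab j (T ++ List.replicate k []) =
      ((slideTab j T).1 ++ List.replicate k [], (slideTab j T).2) := by
  induction T generalizing j with
  | nil =>
    cases k with
    | zero => rfl
    | succ k => cases k <;> simp [slideTab, List.replicate_succ, slideRow]
  | cons r rs ih =>
    have hh : (rs ++ List.replicate k []).headD [] = rs.headD [] := by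
      cases rs with
      | nil => cases k <;> simp [List.replicate_succ]
      | cons => rfl
    rcases h : (slideRow (r.drop (j + 1)) ((rs.headD []).drop j)).2 with _ | i
    · rw [List.cons_append, slideTab_cons_none (by rw [hh, h]), slideTab_cons_none h]
      rfl
    · rw [List.cons_append, slideTab_cons_some (by rw [hh, h]), slideTab_cons_some h, ih, hh]
      rfl

lemma evac_pad (m : ℕ) (T : List (List ℕ)) (k : ℕ) :
    evac m (T ++ List.replicate k []) = evac m T := by
  induction m generalizing T with
  | zero => rfl
  | succ m ih => rw [evac, evac, slideTab_pad, ih]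

/-- Empty rows at the end do not matter when boxes are added. -/
lemma tabFrom_pad {T : List (List ℕ)} {s : ℕ} {l : List ℕ} (hl : Latt (rowLen T) l) (k : ℕ) :
    ∃ k', tabFrom (T ++ List.replicate k []) s l = tabFrom T s l ++ List.replicate k' [] := by
  have key (x b : ℕ) (T : List (List ℕ)) (h : b ≤ T.length) (k : ℕ) :
      ∃ k', appendToRow x b (T ++ List.replicate k []) =
        appendToRow x b T ++ List.replicate k' [] := by
    induction T generalizing b with
    | nil =>
      obtain rfl : b = 0 := by simpa using h
      cases k with
      | zero => exact ⟨0, rfl⟩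
      | succ k => exact ⟨k, rfl⟩
    | cons r rs ih =>
      cases b with
      | zero => exact ⟨k, rfl⟩
      | succ b =>
        obtain ⟨k', h'⟩ := ih b (by simpa using h)
        exact ⟨k', by simp [appendToRow, h']⟩
  induction l generalizing T s k with
  | nil => exact ⟨k, rfl⟩
  | cons b l ih =>
    have hb := addable_le_length hl.1
    obtain ⟨k', h'⟩ := key s b T hb k
    rw [tabFrom, h']
    exact ih (by rw [rowLen_appendToRow s hb]; exact hl.2) k'

/-- On a tableau given by a lattice word, evacuation is `evacWord`. -/
theorem evac_tabFrom {l : List ℕ} (hl : Latt 0 l) :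
    evac l.length (tabFrom [] 0 l) = tabFrom [] 0 (evacWord l.length l) := by
  have hr0 (N : ℕ) : rowLen (List.replicate N []) = 0 := by
    simpa using! rowLen_pad [] N
  have hnil : rowLen [] = 0 := rfl
  suffices ∀ N m s (l : List ℕ), l.length = m → Latt 0 l → (∀ b ∈ l, b < N + 1) →
      evac m (tabFrom (List.replicate (N + 1) []) s l) = tabFrom [] 0 (evacWord m l) by
    obtain ⟨k, hk⟩ := tabFrom_pad (T := []) (s := 0) (l := l) (by rwa [hnil]) (l.sum + 1)
    rw [← this l.sum _ 0 l rfl hl fun b hb => Nat.lt_succ_of_le (List.le_sum_of_mem hb),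
      ← List.nil_append (List.replicate _ _), hk, evac_pad]
  intro N m
  induction m with
  | zero => intros; rfl
  | succ m ih =>
    rintro s (_ | ⟨b, l⟩) h hl hN
    · simp at h
    obtain rfl := latt_zero_cons hl
    have hlen : (slideWord 0 0 l).1.length = m := by simpa [slideWord_length] using h
    have hT : rowLen (appendToRow s 0 (List.replicate (N + 1) [])) = addBox 0 0 := by
      rw [rowLen_appendToRow s (Nat.zero_le _), hr0]
    have hs : slideTab 0 (appendToRow s 0 (List.replicate (N + 1) [])) =
        (List.replicate (N + 1) [], 0) := by
      rw [List.replicate_succ, appendToRow, slideTab_cons_none]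
      · simp
      · cases N <;> simp [List.replicate_succ, slideRow]
    have hslide := slideTab_tabFrom (T := appendToRow s 0 (List.replicate (N + 1) []))
      (s := s + 1) (l := l) (by rw [hT]; simp [addBox])
      (by rw [hT]; exact addBox_antitone zero_antitone (zero_addable _))
      (fun y hy => by
        rcases mem_appendToRow.mp hy with rfl | hy
        · omega
        · simp at hy)
      (fun b hb => by
        rw [length_appendToRow _ (by simp)]
        simpa using hN b (by simp [hb]))
      (by rw [hT]; exact hl.2)
    rw [hs, hr0] at hslide
    rw [evac, tabFrom, hslide, evacWord, tabFrom_concat]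
    simp only
    have hE : (evacWord m (slideWord 0 0 l).1).length = m := by
      rw [← hlen, evacWord_length]
    rw [ih _ _ hlen (slideWord_latt zero_antitone (zero_addable _) hl.2), hE, Nat.zero_add]
    intro b hb
    -- the letters of the slid word are among the rows of the original one
    have h1 := congrFun (slideWord_addBoxes 0 0 l) b
    have h2 := List.count_pos_iff.mpr hb
    refine hN b (List.count_pos_iff.mp ?_)
    simp only [addBox, addBoxes, Pi.zero_apply, zero_add] at h1
    omega

/-! ### Schensted insertion -/

/-- The rows of the boxes created by the successive insertion of the letters of a word. -/
def recRows : List (List ℕ) → List ℕ → List ℕ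
  | _, [] => []
  | T, x :: l => (insertTab x T).2 :: recRows (insertTab x T).1 l

/-- The tableau obtained by the successive insertion of the letters of a word. -/
def insertAll (T : List (List ℕ)) (l : List ℕ) : List (List ℕ) :=
  l.foldl (fun T x => (insertTab x T).1) T

lemma rskWord_eq (l : List ℕ) : rskWord l = (insertAll [] l, tabFrom [] 0 (recRows [] l)) := by
  suffices ∀ P Q s, ((l.zipIdx s).map Prod.swap).foldl rskStep (P, Q) =
      (insertAll P l, tabFrom Q s (recRows P l)) from this [] [] 0
  induction l with
  | nil => intros; rfl
  | cons x l ih =>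
    intro P Q s
    rw [List.zipIdx_cons, List.map_cons, List.foldl_cons]
    exact ih _ _ _

lemma recRows_length (T : List (List ℕ)) (l : List ℕ) : (recRows T l).length = l.length := by
  induction l generalizing T with
  | nil => rfl
  | cons x l ih => simp [recRows, ih]

lemma insertAll_concat (T : List (List ℕ)) (l : List ℕ) (x : ℕ) :
    insertAll T (l ++ [x]) = (insertTab x (insertAll T l)).1 := by
  simp [insertAll]

lemma recRows_concat (T : List (List ℕ)) (l : List ℕ) (x : ℕ) :
    recRows T (l ++ [x]) = recRows T l ++ [(insertTab x (insertAll T l)).2] := by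
  induction l generalizing T with
  | nil => rfl
  | cons y l ih => simp [recRows, ih, insertAll]

lemma rowInsert_perm (x : ℕ) (r : List ℕ) :
    ((rowInsert x r).1 ++ (rowInsert x r).2.toList).Perm (x :: r) := by
  induction r with
  | nil => simp [rowInsert]
  | cons a r ih =>
    rw [rowInsert]
    split_ifs
    · simp
    · exact (ih.cons a).trans (List.Perm.swap _ _ _)

lemma rowInsert_none {x : ℕ} {r : List ℕ} (h : (rowInsert x r).2 = none) :
    (rowInsert x r).1 = r ++ [x] := by
  induction r with
  | nil => rfl
  | cons a r ih =>
    rw [rowInsert] at h ⊢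
    split_ifs at h ⊢
    simp [ih h]

lemma rowInsert_some {x y : ℕ} {r : List ℕ} (h : (rowInsert x r).2 = some y) : y ∈ r := by
  induction r with
  | nil => simp [rowInsert] at h
  | cons a r ih =>
    rw [rowInsert] at h
    split_ifs at h
    · simp_all
    · exact List.mem_cons_of_mem _ (ih h)

lemma rowInsert_of_le {x : ℕ} {r : List ℕ} (h : ∀ y ∈ r, y ≤ x) :
    rowInsert x r = (r ++ [x], none) := by
  induction r with
  | nil => rfl
  | cons a r ih =>
    rw [rowInsert, if_neg (Nat.not_lt.mpr (h a (by simp))), ih fun y hy => h y (by simp [hy])]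
    rfl

lemma rowInsert_sorted {x : ℕ} {r : List ℕ} (hr : r.Pairwise (· < ·)) (hx : x ∉ r) :
    (rowInsert x r).1.Pairwise (· < ·) := by
  induction r with
  | nil => simp [rowInsert]
  | cons a r ih =>
    rw [List.pairwise_cons] at hr
    rw [rowInsert]
    split_ifs with h
    · exact List.pairwise_cons.mpr ⟨fun b hb => h.trans (hr.1 b hb), hr.2⟩
    · refine List.pairwise_cons.mpr ⟨fun b hb => ?_, ih hr.2 fun h' => hx (by simp [h'])⟩
      have hb' := (rowInsert_perm x r).subset (List.mem_append_left _ hb)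
      rcases List.mem_cons.mp hb' with rfl | hb'
      · have : b ≠ a := fun h' => hx (by simp [h'])
        omega
      · exact hr.1 b hb'

/-- Insertion of a larger number bumps a larger entry, if any. -/
lemma rowInsert_lt {x y : ℕ} (hxy : x < y) {r : List ℕ} (hr : r.Pairwise (· < ·)) {v : ℕ}
    (hv : (rowInsert y (rowInsert x r).1).2 = some v) :
    ∃ u, (rowInsert x r).2 = some u ∧ u < v := by
  induction r with
  | nil => simp [rowInsert, Nat.not_lt.mpr hxy.le] at hv
  | cons a r ih =>
    rw [List.pairwise_cons] at hr
    rw [rowInsert] at hv ⊢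
    split_ifs at hv ⊢ with h
    · rw [rowInsert, if_neg (Nat.not_lt.mpr hxy.le)] at hv
      exact ⟨a, rfl, hr.1 v (rowInsert_some hv)⟩
    · rw [rowInsert, if_neg (by omega)] at hv
      exact ih hr.2 hv

/-- Insertion of a smaller number bumps an entry, which is smaller than the previous one. -/
lemma rowInsert_gt {x y : ℕ} (hxy : y < x) {r : List ℕ} (hr : r.Pairwise (· < ·)) :
    ∃ v, (rowInsert y (rowInsert x r).1).2 = some v ∧ ∀ u, (rowInsert x r).2 = some u → v < u := by
  induction r with
  | nil => simp [rowInsert, hxy]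
  | cons a r ih =>
    rw [List.pairwise_cons] at hr
    simp only [rowInsert]
    split_ifs with h
    · simp only [rowInsert, hxy, if_true]
      exact ⟨x, rfl, fun u hu => by simp_all⟩
    · simp only [rowInsert]
      split_ifs with h'
      · exact ⟨a, rfl, fun u hu => hr.1 u (rowInsert_some hu)⟩
      · exact ih hr.2

lemma insertTab_cons_none {x : ℕ} {r : List ℕ} {rs : List (List ℕ)}
    (h : (rowInsert x r).2 = none) : insertTab x (r :: rs) = ((r ++ [x]) :: rs, 0) := by
  have h' := rowInsert_none h
  rw [insertTab]
  split
  · next h1 => rw [h1] at h'; simp_all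
  · next h1 => rw [h1] at h; simp at h

lemma insertTab_cons_some {x y : ℕ} {r : List ℕ} {rs : List (List ℕ)}
    (h : (rowInsert x r).2 = some y) :
    insertTab x (r :: rs) =
      ((rowInsert x r).1 :: (insertTab y rs).1, (insertTab y rs).2 + 1) := by
  rw [insertTab]
  split
  · next h1 => rw [h1] at h; simp at h
  · next h1 => rw [h1] at h ⊢; simp_all

lemma insertTab_flatten (x : ℕ) (T : List (List ℕ)) :
    (insertTab x T).1.flatten.Perm (x :: T.flatten) := by
  induction T generalizing x with
  | nil => simp [insertTab]
  | cons r rs ih =>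
    rcases h : (rowInsert x r).2 with _ | y
    · rw [insertTab_cons_none h]
      simp [List.perm_middle]
    · rw [insertTab_cons_some h]
      have h1 := rowInsert_perm x r
      rw [h] at h1
      simp only [List.flatten_cons]
      refine ((ih y).append_left _).trans ?_
      simpa using h1.append_right rs.flatten

lemma insertAll_flatten (T : List (List ℕ)) (l : List ℕ) :
    (insertAll T l).flatten.Perm (l ++ T.flatten) := by
  induction l generalizing T with
  | nil => rfl
  | cons x l ih =>
    exact (ih _).trans (((insertTab_flatten x T).append_left l).trans List.perm_middle)

lemma insertTab_of_lt {x : ℕ} {T : List (List ℕ)} (h : ∀ y ∈ T.flatten, y < x) :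
    insertTab x T = (appendToRow x 0 T, 0) := by
  cases T with
  | nil => rfl
  | cons r rs =>
    rw [insertTab_cons_none]
    · rfl
    · rw [rowInsert_of_le fun y hy => (h y (by simp [hy])).le]

lemma rowLen_insertTab (x : ℕ) (T : List (List ℕ)) :
    rowLen (insertTab x T).1 = addBox (rowLen T) (insertTab x T).2 := by
  induction T generalizing x with
  | nil => funext i; cases i <;> simp [insertTab, rowLen, addBox]
  | cons r rs ih =>
    funext i
    rcases h : (rowInsert x r).2 with _ | y
    · rw [insertTab_cons_none h]
      cases i <;> simp [rowLen, addBox]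
    · rw [insertTab_cons_some h]
      have h1 := (rowInsert_perm x r).length_eq
      cases i with
      | zero => rw [h] at h1; simpa [rowLen, addBox] using h1
      | succ i => simpa [rowLen, addBox] using congrFun (ih y) i

/-- The row `r` can lie above the row `s` in a column-strict tableau. -/
def Dom : List ℕ → List ℕ → Prop
  | _, [] => True
  | [], _ :: _ => False
  | a :: r, b :: s => a < b ∧ Dom r s

/-- Tableaux with strictly increasing rows and columns. -/
def IsTab : List (List ℕ) → Prop
  | [] => True
  | r :: rs => r.Pairwise (· < ·) ∧ Dom r (rs.headD []) ∧ IsTab rs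

lemma Dom.length_le {r s : List ℕ} (h : Dom r s) : s.length ≤ r.length := by
  induction r generalizing s with
  | nil => cases s <;> simp_all [Dom]
  | cons a r ih =>
    cases s with
    | nil => simp
    | cons b s => simpa using ih h.2

lemma Dom.rowInsert_left {r s : List ℕ} (h : Dom r s) (x : ℕ) : Dom (rowInsert x r).1 s := by
  induction r generalizing s with
  | nil => cases s <;> simp_all [Dom]
  | cons a r ih =>
    cases s with
    | nil => simp [Dom]
    | cons b s =>
      rw [rowInsert]
      split_ifs with h1
      · exact ⟨h1.trans h.1, h.2⟩
      · exact ⟨h.1, ih h.2⟩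

lemma Dom.rowInsert_both {r s : List ℕ} (h : Dom r s) (hr : r.Pairwise (· < ·)) {x y : ℕ}
    (hy : (rowInsert x r).2 = some y) : Dom (rowInsert x r).1 (rowInsert y s).1 := by
  induction r generalizing s with
  | nil => simp [rowInsert] at hy
  | cons a r ih =>
    rw [List.pairwise_cons] at hr
    rw [rowInsert] at hy ⊢
    split_ifs at hy ⊢ with h1
    · obtain rfl : a = y := by simpa using hy
      cases s with
      | nil => simp [rowInsert, Dom, h1]
      | cons b s =>
        rw [rowInsert, if_pos h.1]
        exact ⟨h1, h.2⟩
    · have hay := hr.1 y (rowInsert_some hy)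
      cases s with
      | nil => simp [rowInsert, Dom, hay]
      | cons b s =>
        rw [rowInsert]
        split_ifs
        · exact ⟨hay, h.2.rowInsert_left x⟩
        · exact ⟨h.1, ih h.2 hr.2 hy⟩

lemma IsTab.antitone {T : List (List ℕ)} (h : IsTab T) : Antitone (rowLen T) := by
  refine antitone_nat_of_succ_le fun i => ?_
  induction T generalizing i with
  | nil => simp [rowLen]
  | cons r rs ih =>
    cases i with
    | zero =>
      cases rs with
      | nil => simp [rowLen]
      | cons s ss => simpa [rowLen] using h.2.1.length_le
    | succ i => simpa [rowLen] using ih h.2.2 i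

lemma headD_insertTab (y : ℕ) (T : List (List ℕ)) :
    (insertTab y T).1.headD [] = (rowInsert y (T.headD [])).1 := by
  cases T with
  | nil => rfl
  | cons r rs =>
    rcases h : (rowInsert y r).2 with _ | z
    · rw [insertTab_cons_none h, List.headD_cons, List.headD_cons, rowInsert_none h]
    · rw [insertTab_cons_some h]; rfl

lemma IsTab.insertTab {T : List (List ℕ)} (h : IsTab T) {x : ℕ} (hx : (x :: T.flatten).Nodup) :
    IsTab (insertTab x T).1 := by
  induction T generalizing x with
  | nil => simp [StableSpecht.insertTab, IsTab, Dom]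
  | cons r rs ih =>
    have hxr : x ∉ r := fun h' => (List.nodup_cons.mp hx).1 (by simp [h'])
    have hs := rowInsert_sorted h.1 hxr
    rcases hy : (rowInsert x r).2 with _ | y
    · have hd := h.2.1.rowInsert_left x
      rw [rowInsert_none hy] at hs hd
      rw [insertTab_cons_none hy]
      exact ⟨hs, hd, h.2.2⟩
    · rw [insertTab_cons_some hy]
      refine ⟨hs, ?_, ih h.2.2 ?_⟩
      · rw [headD_insertTab]
        exact h.2.1.rowInsert_both h.1 hy
      · have h1 := (List.nodup_cons.mp hx).2
        rw [List.flatten_cons, List.nodup_append] at h1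
        exact List.nodup_cons.mpr
          ⟨fun h2 => h1.2.2 y (rowInsert_some hy) y h2 rfl, h1.2.1⟩

/-- A word with distinct letters has a recording word which is a lattice word. -/
lemma recRows_latt {T : List (List ℕ)} (h : IsTab T) {l : List ℕ} (hl : (l ++ T.flatten).Nodup) :
    Latt (rowLen T) (recRows T l) := by
  induction l generalizing T with
  | nil => trivial
  | cons x l ih =>
    have h1 : (l ++ (insertTab x T).1.flatten).Nodup :=
      (((insertTab_flatten x T).append_left l).trans List.perm_middle).nodup_iff.mpr hl
    have h2 := h.insertTab (x := x)
      ((insertTab_flatten x T).nodup_iff.mp (List.nodup_append.mp h1).2.1)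
    have h3 := rowLen_insertTab x T
    refine ⟨?_, h3 ▸ ih h2 h1⟩
    intro c hc
    have h4 := h2.antitone (show c ≤ c + 1 by omega)
    rw [h3] at h4
    simp only [addBox] at h4
    grind

lemma IsTab.sorted {T : List (List ℕ)} (h : IsTab T) : ∀ r ∈ T, r.Pairwise (· < ·) := by
  induction T with
  | nil => simp
  | cons r rs ih => simpa using ⟨h.1, ih h.2.2⟩

/-- Row bumping: inserting a larger number creates a box weakly above the previous one. -/
lemma insertTab_row_le {x y : ℕ} (hxy : x < y) {T : List (List ℕ)}
    (hT : ∀ r ∈ T, r.Pairwise (· < ·)) :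
    (insertTab y (insertTab x T).1).2 ≤ (insertTab x T).2 := by
  induction T generalizing x y with
  | nil => simp [insertTab, rowInsert, Nat.not_lt.mpr hxy.le]
  | cons r rs ih =>
    have hr := hT r (by simp)
    rcases hv : (rowInsert y (rowInsert x r).1).2 with _ | v
    · rcases hu : (rowInsert x r).2 with _ | u
      · rw [rowInsert_none hu] at hv
        rw [insertTab_cons_none hu, insertTab_cons_none hv]
      · rw [insertTab_cons_some hu, insertTab_cons_none hv]
        exact Nat.zero_le _
    · obtain ⟨u, hu, huv⟩ := rowInsert_lt hxy hr hv
      rw [insertTab_cons_some hu, insertTab_cons_some hv]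
      exact Nat.succ_le_succ (ih huv fun s hs => hT s (by simp [hs]))

/-- Row bumping: inserting a smaller number creates a box strictly below the previous one. -/
lemma insertTab_row_lt {x y : ℕ} (hxy : y < x) {T : List (List ℕ)}
    (hT : ∀ r ∈ T, r.Pairwise (· < ·)) :
    (insertTab x T).2 < (insertTab y (insertTab x T).1).2 := by
  induction T generalizing x y with
  | nil => simp [insertTab, rowInsert, hxy]
  | cons r rs ih =>
    obtain ⟨v, hv, huv⟩ := rowInsert_gt hxy (hT r (by simp))
    rcases hu : (rowInsert x r).2 with _ | u
    · rw [rowInsert_none hu] at hv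
      rw [insertTab_cons_none hu, insertTab_cons_some hv]
      exact Nat.succ_pos _
    · rw [insertTab_cons_some hu, insertTab_cons_some hv]
      exact Nat.succ_lt_succ (ih (huv u hu) fun s hs => hT s (by simp [hs]))

/-- The places where a word decreases. -/
def drops : List ℕ → List Bool
  | [] => []
  | [_] => []
  | a :: b :: l => decide (b < a) :: drops (b :: l)

/-- The recording tableau has its descents where the word decreases. -/
theorem desc_recRows {T : List (List ℕ)} (h : IsTab T) {l : List ℕ}
    (hl : (l ++ T.flatten).Nodup) : desc (recRows T l) = drops l := by
  induction l generalizing T with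
  | nil => rfl
  | cons x l ih =>
    have h1 : (l ++ (insertTab x T).1.flatten).Nodup :=
      (((insertTab_flatten x T).append_left l).trans List.perm_middle).nodup_iff.mpr hl
    have h2 := h.insertTab (x := x)
      ((insertTab_flatten x T).nodup_iff.mp (List.nodup_append.mp h1).2.1)
    have ih' := ih h2 h1
    cases l with
    | nil => rfl
    | cons y l =>
      simp only [recRows, desc, drops, List.cons.injEq] at ih' ⊢
      refine ⟨?_, ih'⟩
      rw [decide_eq_decide]
      have hne : x ≠ y := by rintro rfl; simp at hl
      constructor
      · intro h3
        by_contra h4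
        have := insertTab_row_le (show x < y by omega) h.sorted
        omega
      · exact fun h3 => insertTab_row_lt h3 h.sorted

lemma length_desc (l : List ℕ) : (desc l).length = l.length - 1 := by
  induction l with
  | nil => rfl
  | cons a l ih => cases l <;> simp_all [desc]

lemma length_drops (l : List ℕ) : (drops l).length = l.length - 1 := by
  induction l with
  | nil => rfl
  | cons a l ih => cases l <;> simp_all [drops]

lemma getElem_desc {l : List ℕ} {i : ℕ} (h : i + 1 < l.length) :
    (desc l)[i]'(by rw [length_desc]; omega) = decide (l[i] < l[i + 1]) := by
  induction l generalizing i with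
  | nil => simp at h
  | cons a l ih =>
    cases l with
    | nil => simp at h
    | cons b l =>
      cases i with
      | zero => rfl
      | succ i => exact ih (i := i) (by simpa using h)

lemma getElem_drops {l : List ℕ} {i : ℕ} (h : i + 1 < l.length) :
    (drops l)[i]'(by rw [length_drops]; omega) = decide (l[i + 1] < l[i]) := by
  induction l generalizing i with
  | nil => simp at h
  | cons a l ih =>
    cases l with
    | nil => simp at h
    | cons b l =>
      cases i with
      | zero => rfl
      | succ i => exact ih (i := i) (by simpa using h)

/-! ### Boxes of a tableau -/

lemma rowOf_cons (r : List ℕ) (T : List (List ℕ)) (p : ℕ) :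
    rowOf (r :: T) p = if p ∈ r then 0 else rowOf T p + 1 := by
  simp only [rowOf, List.findIdx_cons]
  by_cases h : p ∈ r <;> simp [h]

lemma mem_row {T : List (List ℕ)} {p : ℕ} (h : p ∈ T.flatten) : p ∈ T.getD (rowOf T p) [] := by
  induction T with
  | nil => simp at h
  | cons r T ih =>
    rw [rowOf_cons]
    split_ifs with h1
    · simpa using h1
    · rw [List.getD_cons_succ]
      exact ih (by simpa [h1] using h)

lemma mem_flatten_of_mem_getD {T : List (List ℕ)} {p i : ℕ} (h : p ∈ T.getD i []) :
    p ∈ T.flatten := by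
  rw [List.getD_eq_getElem?_getD] at h
  rcases h1 : T[i]? with _ | r
  · simp [h1] at h
  · rw [h1] at h
    exact List.mem_flatten_of_mem (List.mem_of_getElem? h1) h

lemma rowOf_eq {T : List (List ℕ)} (hT : T.flatten.Nodup) {p i : ℕ} (h : p ∈ T.getD i []) :
    rowOf T p = i := by
  induction T generalizing i with
  | nil => simp at h
  | cons r T ih =>
    rw [List.flatten_cons, List.nodup_append] at hT
    rw [rowOf_cons]
    cases i with
    | zero => rw [if_pos (by simpa using h)]
    | succ i =>
      rw [List.getD_cons_succ] at h
      rw [if_neg fun h1 => hT.2.2 p h1 p (mem_flatten_of_mem_getD h) rfl, ih hT.2.1 h]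

lemma colOf_lt {T : List (List ℕ)} {p : ℕ} (h : p ∈ T.flatten) :
    colOf T p < rowLen T (rowOf T p) :=
  List.idxOf_lt_length_of_mem (mem_row h)

lemma entry_rowOf_colOf {T : List (List ℕ)} {p : ℕ} (h : p ∈ T.flatten) :
    entry T (rowOf T p) (colOf T p) = p := by
  rw [entry, List.getD_eq_getElem _ _ (colOf_lt h)]
  exact List.getElem_idxOf _

lemma entry_mem {T : List (List ℕ)} {i j : ℕ} (h : j < rowLen T i) :
    entry T i j ∈ T.getD i [] := by
  rw [entry, List.getD_eq_getElem _ _ h]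
  exact List.getElem_mem _

lemma rowOf_entry {T : List (List ℕ)} (hT : T.flatten.Nodup) {i j : ℕ} (h : j < rowLen T i) :
    rowOf T (entry T i j) = i := rowOf_eq hT (entry_mem h)

lemma nodup_getD {T : List (List ℕ)} (hT : T.flatten.Nodup) (i : ℕ) : (T.getD i []).Nodup := by
  rw [List.getD_eq_getElem?_getD]
  rcases h1 : T[i]? with _ | r
  · simp
  · exact (List.nodup_flatten.mp hT).1 r (List.mem_of_getElem? h1)

lemma colOf_entry {T : List (List ℕ)} (hT : T.flatten.Nodup) {i j : ℕ} (h : j < rowLen T i) :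
    colOf T (entry T i j) = j := by
  rw [colOf, rowOf_entry hT h, entry, List.getD_eq_getElem _ _ h]
  exact (nodup_getD hT i).idxOf_getElem _ h

lemma IsFilling.nodup {n : ℕ} {T : List (List ℕ)} (h : IsFilling n T) : T.flatten.Nodup :=
  h.nodup_iff.mpr List.nodup_range

lemma IsFilling.mem_iff {n : ℕ} {T : List (List ℕ)} (h : IsFilling n T) {p : ℕ} :
    p ∈ T.flatten ↔ p < n := by
  rw [List.Perm.mem_iff h, List.mem_range]

lemma IsFilling.numBoxes {n : ℕ} {T : List (List ℕ)} (h : IsFilling n T) : numBoxes T = n := by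
  have := h.length_eq
  rwa [List.length_flatten, List.length_range] at this

/-- An entry of a tableau is determined by its row and column. -/
lemma IsFilling.ext {n : ℕ} {T : List (List ℕ)} (h : IsFilling n T) {p q : ℕ} (hp : p < n)
    (hq : q < n) (hr : rowOf T p = rowOf T q) (hc : colOf T p = colOf T q) : p = q := by
  rw [← entry_rowOf_colOf (h.mem_iff.mpr hp), ← entry_rowOf_colOf (h.mem_iff.mpr hq), hr, hc]

lemma IsFilling.appendToRow {n : ℕ} {T : List (List ℕ)} (h : IsFilling n T) (k : ℕ) :
    IsFilling (n + 1) (appendToRow n k T) := by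
  refine (flatten_appendToRow n k T).trans ((List.Perm.cons n h).trans ?_)
  rw [List.range_succ]
  exact (List.perm_append_singleton _ _).symm

lemma rowOf_appendToRow {n : ℕ} {T : List (List ℕ)} (h : IsFilling n T) {k : ℕ}
    (hk : k ≤ T.length) {p : ℕ} (hp : p < n) : rowOf (appendToRow n k T) p = rowOf T p := by
  apply rowOf_eq (h.appendToRow k).nodup
  rw [getD_appendToRow n hk]
  exact List.mem_append_left _ (mem_row (h.mem_iff.mpr hp))

lemma colOf_appendToRow {n : ℕ} {T : List (List ℕ)} (h : IsFilling n T) {k : ℕ}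
    (hk : k ≤ T.length) {p : ℕ} (hp : p < n) : colOf (appendToRow n k T) p = colOf T p := by
  rw [colOf, rowOf_appendToRow h hk hp, getD_appendToRow n hk, List.idxOf_append_of_mem]
  · rfl
  · exact mem_row (h.mem_iff.mpr hp)

lemma rowOf_appendToRow_self {n : ℕ} {T : List (List ℕ)} (h : IsFilling n T) {k : ℕ}
    (hk : k ≤ T.length) : rowOf (appendToRow n k T) n = k := by
  apply rowOf_eq (h.appendToRow k).nodup
  rw [getD_appendToRow n hk]
  simp

lemma colOf_appendToRow_self {n : ℕ} {T : List (List ℕ)} (h : IsFilling n T) {k : ℕ}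
    (hk : k ≤ T.length) : colOf (appendToRow n k T) n = rowLen T k := by
  rw [colOf, rowOf_appendToRow_self h hk, getD_appendToRow n hk, if_pos rfl,
    List.idxOf_append_of_notMem]
  · simp [rowLen]
  · intro h1
    have := h.mem_iff.mp (mem_flatten_of_mem_getD h1)
    omega

/-! ### Tableaux given by lattice words, and their cocharge -/

/-- The row of the entry `p` is the letter `p` of the word, and its column counts the preceding equal
letters. -/
lemma tabFrom_facts {e : List ℕ} (he : Latt 0 e) :
    IsFilling e.length (tabFrom [] 0 e) ∧ rowLen (tabFrom [] 0 e) = addBoxes 0 e ∧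
      ∀ p < e.length, rowOf (tabFrom [] 0 e) p = e.getD p 0 ∧
        colOf (tabFrom [] 0 e) p = (e.take p).count (e.getD p 0) := by
  induction e using List.reverseRecOn with
  | nil => exact ⟨List.Perm.refl _, rfl, by simp⟩
  | append_singleton e b ih =>
    obtain ⟨h1, h2⟩ := latt_append.mp he
    obtain ⟨ih1, ih2, ih3⟩ := ih h1
    have hb : b ≤ (tabFrom [] 0 e).length := addable_le_length (by rw [ih2]; exact h2.1)
    rw [tabFrom_concat, Nat.zero_add, List.length_append]
    refine ⟨ih1.appendToRow b, ?_, fun p hp => ?_⟩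
    · rw [rowLen_appendToRow _ hb, ih2, addBoxes_append, addBoxes_cons, addBoxes_nil]
    · rcases Nat.lt_succ_iff_lt_or_eq.mp hp with hp | rfl
      · rw [rowOf_appendToRow ih1 hb hp, colOf_appendToRow ih1 hb hp,
          List.getD_append _ _ _ _ hp, List.take_append_of_le_length hp.le]
        exact ih3 p hp
      · rw [rowOf_appendToRow_self ih1 hb, colOf_appendToRow_self ih1 hb, ih2]
        simp [addBoxes]

/-- The cocharge of the `q`-th letter of a word denoting rows. -/
def cocharge (e : List ℕ) (q : ℕ) : ℕ :=
  ∑ i ∈ Finset.range q, if e.getD i 0 < e.getD (i + 1) 0 then 1 else 0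

/-- For a lattice word the condition on columns in the definition of `dsi` is automatic. -/
lemma dsi_tabFrom {e : List ℕ} (he : Latt 0 e) :
    dsi (tabFrom [] 0 e) =
      (Finset.range (e.length - 1)).filter fun i => e.getD i 0 < e.getD (i + 1) 0 := by
  obtain ⟨h1, -, h3⟩ := tabFrom_facts he
  rw [dsi, h1.numBoxes]
  refine Finset.filter_congr fun i hi => ?_
  have hi' : i + 1 < e.length := by rw [Finset.mem_range] at hi; omega
  rw [(h3 i (by omega)).1, (h3 (i + 1) hi').1, (h3 i (by omega)).2, (h3 (i + 1) hi').2]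
  refine and_iff_left_of_imp fun hlt => ?_
  -- the lattice property after the first `i + 1` letters bounds the column of the next box
  have h4 : e.take (i + 1) = e.take i ++ [e.getD i 0] := by
    rw [List.take_add_one, List.getElem?_eq_getElem (by omega), List.getD_eq_getElem _ _ (by omega)]
    rfl
  have h5 : e = e.take (i + 1) ++ e.getD (i + 1) 0 :: e.drop (i + 2) := by
    rw [List.getD_eq_getElem _ _ hi', ← List.drop_eq_getElem_cons hi', List.take_append_drop]
  rw [h5, latt_append, h4, latt_append] at he
  obtain ⟨⟨h6, h7⟩, h8, -⟩ := he
  have h9 := addBoxes_antitone zero_antitone h6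
  rw [addBoxes_append, addBoxes_cons, addBoxes_nil] at h8
  obtain ⟨c, hc⟩ : ∃ c, e.getD (i + 1) 0 = c + 1 := ⟨e.getD (i + 1) 0 - 1, by omega⟩
  have h10 := h8 c hc
  have h11 := h9 (show e.getD i 0 ≤ c by omega)
  rw [h4, List.count_append, List.count_singleton]
  simp only [addBox, addBoxes, Pi.zero_apply, zero_add] at h10 h11
  grind

lemma entry_ct {S : List (List ℕ)} {i j : ℕ} (h : j < rowLen S i) :
    entry (ct S) i j = ((dsi S).filter (· < entry S i j)).card := by
  have hi : i < S.length := by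
    by_contra hi
    rw [rowLen, List.getD_eq_default _ _ (by omega)] at h
    simp at h
  rw [rowLen, List.getD_eq_getElem _ _ hi] at h
  simp [entry, ct, hi, h]

lemma entry_ct_tabFrom {e : List ℕ} (he : Latt 0 e) {i j : ℕ}
    (h : j < rowLen (tabFrom [] 0 e) i) :
    entry (ct (tabFrom [] 0 e)) i j = cocharge e (entry (tabFrom [] 0 e) i j) := by
  have hlt := (tabFrom_facts he).1.mem_iff.mp (mem_flatten_of_mem_getD (entry_mem h))
  rw [entry_ct h, dsi_tabFrom he, cocharge, ← Finset.card_filter]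
  congr 1
  ext k
  simp only [Finset.mem_filter, Finset.mem_range]
  constructor
  · rintro ⟨⟨-, h1⟩, h2⟩; exact ⟨h2, h1⟩
  · rintro ⟨h1, h2⟩; exact ⟨⟨by omega, h2⟩, h1⟩

/-- The rows and exponents of the monomial `p_T^S` only depend on the word giving `S`. -/
lemma map_entry_ct {n : ℕ} {T : List (List ℕ)} (hT : IsFilling n T) {e : List ℕ} (he : Latt 0 e)
    (hn : e.length = n) (hl : rowLen T = addBoxes 0 e) :
    ((Multiset.range n).map fun p =>
        (rowOf T p, entry (ct (tabFrom [] 0 e)) (rowOf T p) (colOf T p))) =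
      (Multiset.range n).map fun q => (e.getD q 0, cocharge e q) := by
  obtain ⟨h1, h2, h3⟩ := tabFrom_facts he
  rw [hn] at h1
  rw [← h2] at hl
  have hcol (p : ℕ) (hp : p < n) : colOf T p < rowLen (tabFrom [] 0 e) (rowOf T p) :=
    hl ▸ colOf_lt (hT.mem_iff.mpr hp)
  refine Multiset.map_eq_map_of_bij_of_nodup _ _ (Multiset.nodup_range n) (Multiset.nodup_range n)
    (fun p _ => entry (tabFrom [] 0 e) (rowOf T p) (colOf T p)) ?_ ?_ ?_ ?_
  · intro p hp
    rw [Multiset.mem_range] at hp ⊢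
    exact h1.mem_iff.mp (mem_flatten_of_mem_getD (entry_mem (hcol p hp)))
  · intro p hp q hq hpq
    rw [Multiset.mem_range] at hp hq
    have hr := congrArg (rowOf (tabFrom [] 0 e)) hpq
    have hc := congrArg (colOf (tabFrom [] 0 e)) hpq
    rw [rowOf_entry h1.nodup (hcol p hp), rowOf_entry h1.nodup (hcol q hq)] at hr
    rw [colOf_entry h1.nodup (hcol p hp), colOf_entry h1.nodup (hcol q hq)] at hc
    exact hT.ext hp hq hr hc
  · intro q hq
    rw [Multiset.mem_range] at hq
    have hq' := h1.mem_iff.mpr hq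
    have h4 : colOf (tabFrom [] 0 e) q < rowLen T (rowOf (tabFrom [] 0 e) q) :=
      hl ▸ colOf_lt hq'
    refine ⟨entry T (rowOf (tabFrom [] 0 e) q) (colOf (tabFrom [] 0 e) q), ?_, ?_⟩
    · rw [Multiset.mem_range]
      exact hT.mem_iff.mp (mem_flatten_of_mem_getD (entry_mem h4))
    · rw [rowOf_entry hT.nodup h4, colOf_entry hT.nodup h4, entry_rowOf_colOf hq']
  · intro p hp
    rw [Multiset.mem_range] at hp
    have h4 := h1.mem_iff.mp (mem_flatten_of_mem_getD (entry_mem (hcol p hp)))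
    rw [← (h3 _ (hn ▸ h4)).1, rowOf_entry h1.nodup (hcol p hp), entry_ct_tabFrom he (hcol p hp)]

/-- A first-row box put in front shifts all cocharges, since it creates no descent. -/
lemma cocharge_zero_cons {e : List ℕ} (he : Latt 0 e) (q : ℕ) :
    cocharge (0 :: e) (q + 1) = cocharge e q := by
  have h0 : e.getD 0 0 = 0 := by
    cases e with
    | nil => rfl
    | cons b l => exact latt_zero_cons he
  rw [cocharge, Finset.sum_range_succ']
  simp only [List.getD_cons_succ, List.getD_cons_zero, h0]
  simp [cocharge]

/-- The sum of the cocharges, arranged by descents: a descent at the place `i` counts once for each of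
the `n - 1 - i` later letters. -/
lemma sum_cocharge (e : List ℕ) :
    ∑ q ∈ Finset.range e.length, cocharge e q =
      ∑ j ∈ Finset.range (e.length - 1),
        if e.getD (e.length - 2 - j) 0 < e.getD (e.length - 1 - j) 0 then j + 1 else 0 := by
  have key (d : ℕ → ℕ) (m : ℕ) : ∑ q ∈ Finset.range (m + 1), ∑ i ∈ Finset.range q, d i =
      ∑ j ∈ Finset.range m, (j + 1) * d (m - 1 - j) := by
    rw [← Finset.sum_range_reflect fun j => (j + 1) * d (m - 1 - j)]
    have h1 : ∑ j ∈ Finset.range m, (m - 1 - j + 1) * d (m - 1 - (m - 1 - j)) =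
        ∑ j ∈ Finset.range m, (m - j) * d j := by
      refine Finset.sum_congr rfl fun j hj => ?_
      rw [Finset.mem_range] at hj
      rw [show m - 1 - (m - 1 - j) = j by omega, show m - 1 - j + 1 = m - j by omega]
    rw [h1]
    clear h1
    induction m with
    | zero => simp
    | succ m ih =>
      rw [Finset.sum_range_succ, ih]
      have h2 : ∑ j ∈ Finset.range (m + 1), (m + 1 - j) * d j =
          ∑ j ∈ Finset.range (m + 1), ((m - j) * d j + d j) := by
        refine Finset.sum_congr rfl fun j hj => ?_
        rw [Finset.mem_range] at hj
        rw [show m + 1 - j = m - j + 1 by omega]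
        ring
      rw [h2, Finset.sum_add_distrib, Finset.sum_range_succ (fun j => (m - j) * d j)]
      simp
  rcases h : e.length with _ | m
  · simp
  · rw [show m + 1 - 1 = m by omega]
    simp only [cocharge]
    rw [key]
    refine Finset.sum_congr rfl fun j hj => ?_
    rw [Finset.mem_range] at hj
    rw [show m + 1 - 2 - j = m - 1 - j by omega, show m - 1 - j + 1 = m - j by omega]
    simp

/-! ### The tableaux of a permutation -/

lemma embPerm_of_lt {n : ℕ} (u : Perm (Fin n)) {p : ℕ} (h : p < n) :
    embPerm n u p = u ⟨p, h⟩ :=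
  Perm.extendDomain_apply_subtype u Fin.equivSubtype h

lemma embPerm_of_le {n : ℕ} (u : Perm (Fin n)) {p : ℕ} (h : n ≤ p) : embPerm n u p = p :=
  Perm.extendDomain_apply_not_subtype u Fin.equivSubtype (not_lt.mpr h)

lemma embPerm_lt_iff {n : ℕ} (u : Perm (Fin n)) (p : ℕ) : embPerm n u p < n ↔ p < n := by
  constructor
  · intro h
    by_contra h1
    rw [embPerm_of_le u (not_lt.mp h1)] at h
    exact h1 h
  · intro h
    rw [embPerm_of_lt u h]
    exact (u _).2

lemma oneLine_eq {n : ℕ} (u : Perm (Fin n)) : oneLine u = (List.range n).map (embPerm n u) := by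
  apply List.ext_getElem
  · simp [oneLine]
  · intro i h1 h2
    have hi : i < n := by simpa using h2
    simp [oneLine, embPerm_of_lt u hi]

lemma oneLine_perm {n : ℕ} (u : Perm (Fin n)) : (oneLine u).Perm (List.range n) := by
  rw [oneLine_eq, List.perm_ext_iff_of_nodup (List.nodup_range.map (embPerm n u).injective)
    List.nodup_range]
  intro p
  simp only [List.mem_map, List.mem_range]
  constructor
  · rintro ⟨q, hq, rfl⟩
    exact (embPerm_lt_iff u q).mpr hq
  · intro hp
    refine ⟨(embPerm n u).symm p, ?_, by simp⟩
    rw [← embPerm_lt_iff u]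
    simpa using hp

lemma oneLine_length {n : ℕ} (u : Perm (Fin n)) : (oneLine u).length = n := by
  simp [oneLine]

lemma oneLine_nodup {n : ℕ} (u : Perm (Fin n)) :
    (oneLine u ++ ([] : List (List ℕ)).flatten).Nodup := by
  simpa using (oneLine_perm u).nodup_iff.mpr List.nodup_range

lemma rowLen_insertAll (T : List (List ℕ)) (l : List ℕ) :
    rowLen (insertAll T l) = addBoxes (rowLen T) (recRows T l) := by
  induction l generalizing T with
  | nil => simp [insertAll, recRows]
  | cons x l ih =>
    rw [recRows, addBoxes_cons, ← rowLen_insertTab]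
    exact ih _

/-- The rows of the entries `0, 1, …` of the recording tableau `Q(u)`. -/
def recWord {n : ℕ} (u : Perm (Fin n)) : List ℕ := recRows [] (oneLine u)

/-- The rows of the entries `0, 1, …` of the tableau `ev Q(u)`. -/
def evWord {n : ℕ} (u : Perm (Fin n)) : List ℕ := evacWord n (recWord u)

lemma recWord_length {n : ℕ} (u : Perm (Fin n)) : (recWord u).length = n := by
  rw [recWord, recRows_length, oneLine_length]

lemma recWord_latt {n : ℕ} (u : Perm (Fin n)) : Latt 0 (recWord u) :=
  recRows_latt (T := []) trivial (oneLine_nodup u)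

lemma evWord_length {n : ℕ} (u : Perm (Fin n)) : (evWord u).length = n := by
  have := evacWord_length (recWord u)
  rwa [recWord_length] at this

lemma evWord_latt {n : ℕ} (u : Perm (Fin n)) : Latt 0 (evWord u) := by
  have := evacWord_latt (recWord_latt u)
  rwa [recWord_length] at this

lemma tabP_eq {n : ℕ} (u : Perm (Fin n)) : tabP u = insertAll [] (oneLine u) := by
  rw [tabP, rskWord_eq]

lemma tabQt_eq {n : ℕ} (u : Perm (Fin n)) : tabQt u = tabFrom [] 0 (evWord u) := by
  have := evac_tabFrom (recWord_latt u)
  rw [recWord_length] at this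
  rw [tabQt, tabQ, rskWord_eq]
  exact this

lemma isFilling_tabP {n : ℕ} (u : Perm (Fin n)) : IsFilling n (tabP u) := by
  rw [tabP_eq, IsFilling]
  exact (insertAll_flatten [] (oneLine u)).trans (by simpa using oneLine_perm u)

lemma rowLen_tabP {n : ℕ} (u : Perm (Fin n)) : rowLen (tabP u) = addBoxes 0 (evWord u) := by
  rw [tabP_eq, rowLen_insertAll]
  funext i
  have := evacWord_count (recWord_latt u) i
  rw [recWord_length] at this
  simp only [addBoxes]
  rw [evWord, this]
  rfl

/-- The multiset of the pairs formed by the row of a box of `P(u)` and the exponent in the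
monomial `p_T^S` of the variable in this box. -/
def rowExps {n : ℕ} (u : Perm (Fin n)) : Multiset (ℕ × ℕ) :=
  (Multiset.range n).map fun p => (rowOf (tabP u) p,
    entry (ct (tabQt u)) (rowOf (tabP u) p) (colOf (tabP u) p))

lemma rowExps_eq {n : ℕ} (u : Perm (Fin n)) : rowExps u =
    (Multiset.range n).map fun q => ((evWord u).getD q 0, cocharge (evWord u) q) := by
  rw [rowExps, tabQt_eq]
  exact map_entry_ct (isFilling_tabP u) (evWord_latt u) (evWord_length u) (rowLen_tabP u)

/-- The pairs in `rowExps u` with non-zero exponents. -/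
def rowExpsNZ {n : ℕ} (u : Perm (Fin n)) : Multiset (ℕ × ℕ) :=
  (rowExps u).filter fun a => a.2 ≠ 0

/-- The descents of `ev Q(u)` are those of `u` in the reverse order. -/
lemma desc_evWord {n : ℕ} (u : Perm (Fin n)) :
    desc (evWord u) = (drops (oneLine u)).reverse := by
  have := desc_evacWord (recWord_latt u)
  rw [recWord_length] at this
  rw [evWord, this, recWord, desc_recRows (T := []) trivial (oneLine_nodup u)]

/-- The degree of the higher Specht polynomial. -/
theorem sum_rowExpsNZ {n : ℕ} (u : Perm (Fin n)) (w : SInf) (h : embPerm n u = w) :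
    ((rowExpsNZ u).map Prod.snd).sum = ∑ i ∈ dsl w, i := by
  have h1 : ((rowExpsNZ u).map Prod.snd).sum = ((rowExps u).map Prod.snd).sum := by
    rw [rowExpsNZ, ← Multiset.filter_add_not (fun a : ℕ × ℕ => a.2 ≠ 0) (rowExps u)]
    rw [Multiset.map_add, Multiset.sum_add, Multiset.filter_add_not]
    refine (Nat.add_eq_left.mpr (Multiset.sum_eq_zero fun x hx => ?_)).symm
    obtain ⟨a, ha, rfl⟩ := Multiset.mem_map.mp hx
    simpa using (Multiset.mem_filter.mp ha).2
  have h2 : ((rowExps u).map Prod.snd).sum =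
      ∑ q ∈ Finset.range (evWord u).length, cocharge (evWord u) q := by
    rw [rowExps_eq, Multiset.map_map, evWord_length]
    rfl
  rw [h1, h2, sum_cocharge, evWord_length]
  have h3 (j : ℕ) (hj : j ∈ Finset.range (n - 1)) :
      (if (evWord u).getD (n - 2 - j) 0 < (evWord u).getD (n - 1 - j) 0 then j + 1 else 0) =
        if embPerm n u (j + 1) < embPerm n u j then j + 1 else 0 := by
    rw [Finset.mem_range] at hj
    have hlen := evWord_length u
    have hlen' := oneLine_length u
    have h4 := getElem_desc (l := evWord u) (i := n - 2 - j) (by omega)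
    have h5 := getElem_drops (l := oneLine u) (i := j) (by omega)
    simp only [desc_evWord, List.getElem_reverse, length_drops, hlen'] at h4
    simp only [show n - 1 - 1 - (n - 2 - j) = j by omega, h5, decide_eq_decide,
      show n - 2 - j + 1 = n - 1 - j by omega] at h4
    rw [List.getD_eq_getElem _ _ (by omega), List.getD_eq_getElem _ _ (by omega)]
    simp only [← h4, oneLine_eq, List.getElem_map, List.getElem_range]
  rw [Finset.sum_congr rfl h3, ← Finset.sum_filter]
  have h6 : dsl w = ((Finset.range (n - 1)).filter fun j =>
      embPerm n u (j + 1) < embPerm n u j).image (· + 1) := by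
    ext i
    rw [dsl, Set.Finite.mem_toFinset, Set.mem_ofPred_eq, ← h]
    simp only [Finset.mem_image, Finset.mem_filter, Finset.mem_range]
    constructor
    · rintro ⟨j, rfl, hj⟩
      refine ⟨j, ⟨?_, hj⟩, rfl⟩
      by_contra hn
      rw [embPerm_of_le u (show n ≤ j + 1 by omega)] at hj
      by_cases hjn : j < n
      · have := (embPerm_lt_iff u j).mpr hjn
        omega
      · rw [embPerm_of_le u (by omega)] at hj
        omega
    · rintro ⟨j, ⟨-, hj⟩, rfl⟩
      exact ⟨j, rfl, hj⟩
  rw [h6, Finset.sum_image fun a _ b _ hab => by simpa using hab]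

/-! ### Adding a fixed point -/

lemma oneLine_succ {n : ℕ} {u : Perm (Fin n)} {u' : Perm (Fin (n + 1))}
    (h : embPerm (n + 1) u' = embPerm n u) : oneLine u' = oneLine u ++ [n] := by
  rw [oneLine_eq, oneLine_eq, h, List.range_succ, List.map_append, List.map_singleton,
    embPerm_of_le u le_rfl]

lemma tabP_succ {n : ℕ} {u : Perm (Fin n)} {u' : Perm (Fin (n + 1))}
    (h : embPerm (n + 1) u' = embPerm n u) : tabP u' = appendToRow n 0 (tabP u) := by
  rw [tabP_eq, tabP_eq, oneLine_succ h, insertAll_concat, insertTab_of_lt]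
  intro y hy
  rw [← tabP_eq] at hy
  exact (isFilling_tabP u).mem_iff.mp hy

lemma evWord_succ {n : ℕ} {u : Perm (Fin n)} {u' : Perm (Fin (n + 1))}
    (h : embPerm (n + 1) u' = embPerm n u) : evWord u' = 0 :: evWord u := by
  have h1 : recWord u' = recWord u ++ [0] := by
    rw [recWord, recWord, oneLine_succ h, recRows_concat, insertTab_of_lt]
    intro y hy
    rw [← tabP_eq] at hy
    exact (isFilling_tabP u).mem_iff.mp hy
  have h2 := evacWord_concat_zero (recWord u)
  rw [recWord_length] at h2
  rw [evWord, h1, h2, evWord]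

lemma rowExpsNZ_succ {n : ℕ} {u : Perm (Fin n)} {u' : Perm (Fin (n + 1))}
    (h : embPerm (n + 1) u' = embPerm n u) : rowExpsNZ u' = rowExpsNZ u := by
  have h1 : Multiset.range (n + 1) = 0 ::ₘ (Multiset.range n).map Nat.succ := by
    rw [Multiset.range, List.range_succ_eq_map]
    rfl
  rw [rowExpsNZ, rowExpsNZ, rowExps_eq, rowExps_eq, evWord_succ h, h1, Multiset.map_cons,
    Multiset.filter_cons_of_neg _ (by simp [cocharge]), Multiset.map_map]
  simp [cocharge_zero_cons (evWord_latt u)]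

/-! ### Exponents in rows -/

/-- The action of permutations on exponents of monomials. -/
noncomputable def actExp (σ : Perm ℕ) (f : ℕ →₀ ℕ) : ℕ →₀ ℕ := Finsupp.equivMapDomain σ f

lemma actExp_apply (σ : Perm ℕ) (f : ℕ →₀ ℕ) (p : ℕ) : actExp σ f p = f (σ⁻¹ p) := rfl

lemma actExp_mul (σ τ : Perm ℕ) (f : ℕ →₀ ℕ) : actExp (σ * τ) f = actExp σ (actExp τ f) := by
  ext p
  simp only [actExp_apply, mul_inv_rev, Perm.mul_apply]

lemma coeff_permAct (σ : Perm ℕ) (F : MvPowerSeries ℕ ℚ) (f : ℕ →₀ ℕ) :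
    MvPowerSeries.coeff f (permAct σ F) = MvPowerSeries.coeff (actExp σ⁻¹ f) F := by
  have h := MvPowerSeries.coeff_embDomain_rename σ.toEmbedding F (actExp σ⁻¹ f)
  have h1 : Finsupp.embDomain σ.toEmbedding (actExp σ⁻¹ f) = f := by
    ext p
    have h2 := Finsupp.embDomain_apply_self σ.toEmbedding (actExp σ⁻¹ f) (σ⁻¹ p)
    simpa [actExp_apply] using h2
  rw [h1] at h
  exact h

/-- The non-zero exponents of a monomial, each together with the row of its variable as given
by the function `r`, form the multiset `M`. -/
def HasExps (r : ℕ → ℕ) (M : Multiset (ℕ × ℕ)) (f : ℕ →₀ ℕ) : Prop :=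
  (f.support.val.map fun p => (r p, f p)) = M

lemma hasExps_actExp {r : ℕ → ℕ} {M : Multiset (ℕ × ℕ)} {σ : Perm ℕ} (h : ∀ p, r (σ p) = r p)
    (f : ℕ →₀ ℕ) : HasExps r M (actExp σ f) ↔ HasExps r M f := by
  have h1 : (actExp σ f).support.val = f.support.val.map σ := rfl
  rw [HasExps, HasExps, h1, Multiset.map_map]
  simp [h, actExp_apply]

lemma HasExps.degree {r : ℕ → ℕ} {M : Multiset (ℕ × ℕ)} {f : ℕ →₀ ℕ} (h : HasExps r M f) :
    f.degree = (M.map Prod.snd).sum := by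
  rw [← h, Multiset.map_map]
  rfl

lemma degree_actExp (σ : Perm ℕ) (f : ℕ →₀ ℕ) : (actExp σ f).degree = f.degree := by
  have h := (hasExps_actExp (r := fun _ => 0) (σ := σ) (fun _ => rfl) f).mpr rfl
  rw [h.degree, HasExps.degree rfl]

/-- The row of a variable: the first row of `T` is extended by all the numbers from `n` on. -/
def rowInf (n : ℕ) (T : List (List ℕ)) (p : ℕ) : ℕ := if p < n then rowOf T p else 0

open scoped Classical in
/-- The stable higher Specht series of `u`: the antisymmetrization, with respect to the column
group of `P(u)`, of the sum of all the monomials with exponents `rowExpsNZ u`, where the first row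
of `P(u)` is extended by all the variables which are not in the tableau. -/
noncomputable def stableSeries {n : ℕ} (u : Perm (Fin n)) : MvPowerSeries ℕ ℚ := fun f =>
  ∑ σ : colGroup n (tabP u),
    if HasExps (rowInf n (tabP u)) (rowExpsNZ u) (actExp (embPerm n σ)⁻¹ f) then
      ((Perm.sign (σ : Perm (Fin n)) : ℤ) : ℚ) else 0

open scoped Classical in
lemma coeff_stableSeries {n : ℕ} (u : Perm (Fin n)) (f : ℕ →₀ ℕ) :
    MvPowerSeries.coeff f (stableSeries u) = ∑ σ : colGroup n (tabP u),
      if HasExps (rowInf n (tabP u)) (rowExpsNZ u) (actExp (embPerm n σ)⁻¹ f) then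
        ((Perm.sign (σ : Perm (Fin n)) : ℤ) : ℚ) else 0 := rfl

lemma isHomogeneous_stableSeries {n : ℕ} (u : Perm (Fin n)) :
    (stableSeries u).IsHomogeneous ((rowExpsNZ u).map Prod.snd).sum := by
  classical
  intro f hf
  rw [coeff_stableSeries] at hf
  obtain ⟨σ, -, hσ⟩ := Finset.exists_ne_zero_of_sum_ne_zero hf
  have h := (ite_ne_right_iff.mp hσ).1
  rw [← h.degree, degree_actExp, Finsupp.degree_eq_weight_one]
  rfl

/-! ### Symmetries of the stable series -/

lemma rowInf_of_fixes {n : ℕ} {T : List (List ℕ)} {σ : Perm ℕ} (h : ∀ i, i < n → σ i = i)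
    (p : ℕ) : rowInf n T (σ p) = rowInf n T p := by
  by_cases hp : p < n
  · rw [h p hp]
  · have h1 : ¬ σ p < n := fun h1 => hp (σ.injective (h _ h1) ▸ h1)
    rw [rowInf, rowInf, if_neg hp, if_neg h1]

/-- A permutation of the variables outside the tableau only moves variables of the extended first
row, and commutes with the column group. -/
lemma permAct_of_fixes {n : ℕ} (u : Perm (Fin n)) {σ : Perm ℕ} (h : ∀ i, i < n → σ i = i) :
    permAct σ (stableSeries u) = stableSeries u := by
  classical
  ext f
  rw [coeff_permAct, coeff_stableSeries, coeff_stableSeries]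
  refine Finset.sum_congr rfl fun τ _ => ?_
  have hd : Perm.Disjoint (embPerm n τ) σ := fun i => by
    by_cases hi : i < n
    · exact Or.inr (h i hi)
    · exact Or.inl (embPerm_of_le _ (not_lt.mp hi))
  have hc : (embPerm n τ)⁻¹ * σ⁻¹ = σ⁻¹ * (embPerm n τ)⁻¹ := hd.commute.inv_inv
  have hi : ∀ i, i < n → σ⁻¹ i = i := fun i hi => by
    rw [Perm.inv_eq_iff_eq, h i hi]
  rw [← actExp_mul, hc, actExp_mul]
  simp only [hasExps_actExp (rowInf_of_fixes hi)]

lemma rowInf_embPerm {n : ℕ} {T : List (List ℕ)} {g : Perm (Fin n)}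
    (h : ∀ p : Fin n, rowOf T (g p) = rowOf T p) (p : ℕ) :
    rowInf n T (embPerm n g p) = rowInf n T p := by
  by_cases hp : p < n
  · rw [rowInf, rowInf, if_pos hp, if_pos ((embPerm_lt_iff g p).mpr hp), embPerm_of_lt g hp]
    exact h ⟨p, hp⟩
  · rw [embPerm_of_le g (not_lt.mp hp)]

lemma permAct_colGroup {n : ℕ} (u : Perm (Fin n)) {g : Perm (Fin n)}
    (hg : g ∈ colGroup n (tabP u)) :
    permAct (embPerm n g) (stableSeries u) = ((Perm.sign g : ℤ) : ℚ) • stableSeries u := by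
  classical
  ext f
  rw [coeff_permAct, MvPowerSeries.coeff_smul, coeff_stableSeries, coeff_stableSeries,
    Finset.mul_sum]
  refine Fintype.sum_equiv (Equiv.mulLeft (⟨g, hg⟩ : colGroup n (tabP u))) _ _ fun σ => ?_
  have h1 : (((Equiv.mulLeft (⟨g, hg⟩ : colGroup n (tabP u))) σ : colGroup n (tabP u)) :
      Perm (Fin n)) = g * σ := rfl
  rw [h1, map_mul, mul_inv_rev, actExp_mul, mul_ite, mul_zero]
  refine if_congr Iff.rfl ?_ rfl
  rw [map_mul, ← Int.cast_mul, ← Units.val_mul, ← mul_assoc, Int.units_mul_self, one_mul]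

lemma conj_mem_colGroup {n : ℕ} {T : List (List ℕ)} {h σ : Perm (Fin n)}
    (hh : h ∈ colPermGroup n T) (hσ : σ ∈ colGroup n T) : h * σ * h⁻¹ ∈ colGroup n T := by
  obtain ⟨η, -, h2⟩ := hh
  intro p
  have h3 := (h2 (h⁻¹ p)).2
  rw [show h (h⁻¹ p) = p by simp] at h3
  rw [Perm.mul_apply, Perm.mul_apply, (h2 _).2, hσ, h3]

/-- A permutation of whole columns preserves the rows and normalizes the column group. -/
lemma permAct_colPermGroup {n : ℕ} (u : Perm (Fin n)) {g : Perm (Fin n)}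
    (hg : g ∈ colPermGroup n (tabP u)) :
    permAct (embPerm n g) (stableSeries u) = stableSeries u := by
  classical
  have hrow : ∀ p : Fin n, rowOf (tabP u) (g⁻¹ p) = rowOf (tabP u) p := by
    obtain ⟨η, -, h2⟩ := (colPermGroup n (tabP u)).inv_mem hg
    exact fun p => (h2 p).1
  have hinv (σ : Perm (Fin n)) (hσ : σ ∈ colGroup n (tabP u)) :
      g⁻¹ * σ * g ∈ colGroup n (tabP u) := by
    simpa using conj_mem_colGroup ((colPermGroup n (tabP u)).inv_mem hg) hσ
  ext f
  rw [coeff_permAct, coeff_stableSeries, coeff_stableSeries]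
  -- `g σ = (g σ g⁻¹) g`, where `g` preserves the rows
  refine Fintype.sum_equiv
    { toFun := fun σ : colGroup n (tabP u) =>
        (⟨g * σ * g⁻¹, conj_mem_colGroup hg σ.2⟩ : colGroup n (tabP u))
      invFun := fun σ : colGroup n (tabP u) => ⟨g⁻¹ * σ * g, hinv σ σ.2⟩
      left_inv := fun σ => Subtype.ext (by simp [mul_assoc])
      right_inv := fun σ => Subtype.ext (by simp [mul_assoc]) } _ _ fun σ => ?_
  have h1 : (embPerm n σ)⁻¹ * (embPerm n g)⁻¹ =
      embPerm n g⁻¹ * (embPerm n (g * σ * g⁻¹))⁻¹ := by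
    simp only [map_mul, map_inv]
    group
  rw [← actExp_mul, h1, actExp_mul]
  refine if_congr (hasExps_actExp (rowInf_embPerm hrow) _) ?_ rfl
  simp only [Equiv.coe_fn_mk, map_mul, map_inv]
  rw [mul_comm (Perm.sign g), mul_assoc, mul_inv_cancel, mul_one]

/-- A homomorphism to a commutative group, restricted to a subgroup `K`, extends by `1` to the
product of `K` with a subgroup `H` which normalizes `K` and meets it trivially. -/
lemma exists_hom_sup {G A : Type*} [Group G] [CommGroup A] {E H K : Subgroup G} (hE : E = H ⊔ K)
    (hn : ∀ h ∈ H, ∀ k ∈ K, h * k * h⁻¹ ∈ K) (hd : ∀ g ∈ H, g ∈ K → g = 1) (s : G →* A) :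
    ∃ χ : E →* A, ∀ g : E, ∃ h ∈ H, ∃ k ∈ K, (g : G) = h * k ∧ χ g = s k := by
  have hn' : ∀ h ∈ H, ∀ k ∈ K, h⁻¹ * k * h ∈ K := fun h hh k hk => by
    simpa using hn h⁻¹ (H.inv_mem hh) k hk
  have hex (g : E) : ∃ a : G × G, a.1 ∈ H ∧ a.2 ∈ K ∧ (g : G) = a.1 * a.2 := by
    let L : Subgroup G :=
      { carrier := {g | ∃ a : G × G, a.1 ∈ H ∧ a.2 ∈ K ∧ g = a.1 * a.2}
        one_mem' := ⟨(1, 1), H.one_mem, K.one_mem, by simp⟩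
        mul_mem' := by
          rintro _ _ ⟨⟨h, k⟩, hh, hk, rfl⟩ ⟨⟨h', k'⟩, hh', hk', rfl⟩
          exact ⟨(h * h', h'⁻¹ * k * h' * k'), H.mul_mem hh hh',
            K.mul_mem (hn' h' hh' k hk) hk', by group⟩
        inv_mem' := by
          rintro _ ⟨⟨h, k⟩, hh, hk, rfl⟩
          exact ⟨(h⁻¹, h * k⁻¹ * h⁻¹), H.inv_mem hh, hn h hh _ (K.inv_mem hk), by group⟩ }
    have hL : E ≤ L := hE ▸ sup_le (fun h hh => ⟨(h, 1), hh, K.one_mem, by simp⟩)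
      fun k hk => ⟨(1, k), H.one_mem, hk, by simp⟩
    exact hL g.2
  have huniq {h k h' k' : G} (hh : h ∈ H) (hk : k ∈ K) (hh' : h' ∈ H) (hk' : k' ∈ K)
      (he : h * k = h' * k') : k = k' := by
    have h1 : h'⁻¹ * h = k' * k⁻¹ := by
      rw [inv_mul_eq_iff_eq_mul, ← mul_assoc, ← he, mul_inv_cancel_right]
    have h2 := hd _ (H.mul_mem (H.inv_mem hh') hh) (h1 ▸ K.mul_mem hk' (K.inv_mem hk))
    rw [h1, mul_inv_eq_one] at h2
    exact h2.symm
  choose a ha1 ha2 ha3 using hex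
  refine ⟨MonoidHom.mk' (fun g => s (a g).2) fun g g' => ?_,
    fun g => ⟨(a g).1, ha1 g, (a g).2, ha2 g, ha3 g, rfl⟩⟩
  have h1 : (a (g * g')).2 = (a g').1⁻¹ * (a g).2 * (a g').1 * (a g').2 := by
    refine huniq (ha1 (g * g')) (ha2 (g * g')) (H.mul_mem (ha1 g) (ha1 g'))
      (K.mul_mem (hn' _ (ha1 g') _ (ha2 g)) (ha2 g')) ?_
    rw [← ha3, Subgroup.coe_mul, ha3 g, ha3 g']
    group
  rw [h1, map_mul, map_mul, map_mul, map_inv, mul_right_comm _ (s (a g).2), inv_mul_cancel, one_mul]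

lemma eq_one_of_mem_colPermGroup {n : ℕ} {T : List (List ℕ)} (hT : IsFilling n T)
    {g : Perm (Fin n)} (h1 : g ∈ colPermGroup n T) (h2 : g ∈ colGroup n T) : g = 1 := by
  obtain ⟨η, -, h3⟩ := h1
  ext p
  exact hT.ext (g p).2 p.2 (h3 p).1 (h2 p)

/-- The extended column group acts on the stable series via the extended sign. -/
theorem exists_extSign {n : ℕ} (u : Perm (Fin n)) :
    ∃ χ : extColGroup n (tabP u) →* ℤˣ, IsExtSign χ ∧
      ∀ g : extColGroup n (tabP u),
        permAct (embPerm n (g : Perm (Fin n))) (stableSeries u) =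
          ((χ g : ℤ) : ℚ) • stableSeries u := by
  obtain ⟨χ, hχ⟩ := exists_hom_sup (E := extColGroup n (tabP u)) rfl
    (fun h hh k hk => conj_mem_colGroup hh hk)
    (fun g h1 h2 => eq_one_of_mem_colPermGroup (isFilling_tabP u) h1 h2) Perm.sign
  refine ⟨χ, ⟨fun g hg => ?_, fun g hg => ?_⟩, fun g => ?_⟩
  · obtain ⟨h, hh, k, hk, h1, h2⟩ := hχ g
    have h3 : k = h⁻¹ * g := by rw [h1, inv_mul_cancel_left]
    have h4 := eq_one_of_mem_colPermGroup (isFilling_tabP u)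
      (h3 ▸ Subgroup.mul_mem _ (Subgroup.inv_mem _ hh) hg) hk
    rw [h2, h4, map_one]
  · obtain ⟨h, hh, k, hk, h1, h2⟩ := hχ g
    have h3 : h = g * k⁻¹ := by rw [h1, mul_inv_cancel_right]
    have h4 := eq_one_of_mem_colPermGroup (isFilling_tabP u) hh
      (h3 ▸ Subgroup.mul_mem _ hg (Subgroup.inv_mem _ hk))
    rw [h2, h1, h4, one_mul]
  · obtain ⟨h, hh, k, hk, h1, h2⟩ := hχ g
    rw [h1, h2, ← permAct_colGroup u hk]
    conv_rhs => rw [permAct_colGroup u hk, ← permAct_colPermGroup u hh]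
    have h3 : permAct (embPerm n (h * k)) (stableSeries u) =
        permAct (embPerm n h) (permAct (embPerm n k) (stableSeries u)) := by
      ext f
      rw [coeff_permAct, coeff_permAct, coeff_permAct, map_mul, mul_inv_rev, actExp_mul]
    rw [h3, permAct_colGroup u hk]
    ext f
    simp only [coeff_permAct, MvPowerSeries.coeff_smul]

/-! ### Independence of the number of variables -/

lemma exists_embPerm {n : ℕ} {σ : Perm ℕ} (hn : ∀ i, n ≤ i → σ i = i) :
    ∃ v : Perm (Fin n), embPerm n v = σ := by
  have hlt : ∀ i, σ i < n ↔ i < n := fun i => by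
    constructor
    · intro hi
      by_contra h
      rw [hn i (not_lt.mp h)] at hi
      exact h hi
    · intro hi
      by_contra h
      have h2 := σ.injective (hn (σ i) (not_lt.mp h))
      omega
  refine ⟨Fin.equivSubtype.symm.permCongr (σ.subtypePerm hlt), ?_⟩
  ext i
  by_cases hi : i < n
  · rw [embPerm_of_lt _ hi]
    simp [Equiv.permCongr_apply]
  · rw [embPerm_of_le _ (not_lt.mp hi), hn i (not_lt.mp hi)]

lemma embPerm_injective (n : ℕ) : Function.Injective (embPerm n) :=
  Perm.extendDomainHom_injective Fin.equivSubtype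

lemma exists_extend {n : ℕ} (v : Perm (Fin n)) :
    ∃ v' : Perm (Fin (n + 1)), embPerm (n + 1) v' = embPerm n v ∧ Perm.sign v' = Perm.sign v := by
  let f : Fin n ≃ {p : Fin (n + 1) // p ≠ Fin.last n} :=
    finSuccAboveEquiv (Fin.last n)
  have hf (p : Fin n) : ((f p : Fin (n + 1)) : ℕ) = p := by
    simp [f, finSuccAboveEquiv_apply]
  refine ⟨v.extendDomain f, ?_, Perm.sign_extendDomain v f⟩
  ext i
  rcases lt_trichotomy i n with hi | rfl | hi
  · have h1 : (⟨i, by omega⟩ : Fin (n + 1)) = f ⟨i, hi⟩ := Fin.ext (hf ⟨i, hi⟩).symm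
    rw [embPerm_of_lt _ (show i < n + 1 by omega), embPerm_of_lt _ hi, h1,
      Perm.extendDomain_apply_image, hf]
  · rw [embPerm_of_lt _ (show i < i + 1 by omega), embPerm_of_le v le_rfl,
      Perm.extendDomain_apply_not_subtype]
    simp [Fin.ext_iff]
  · rw [embPerm_of_le _ (show n + 1 ≤ i by omega), embPerm_of_le _ hi.le]

lemma mem_colGroup_iff {n : ℕ} {T : List (List ℕ)} {σ : Perm (Fin n)} :
    σ ∈ colGroup n T ↔ ∀ p < n, colOf T (embPerm n σ p) = colOf T p := by
  constructor
  · intro h p hp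
    rw [embPerm_of_lt σ hp]
    exact h ⟨p, hp⟩
  · intro h p
    have := h p p.2
    rwa [embPerm_of_lt σ p.2] at this

/-- The column group does not change if a box is added at the end of the first row. -/
lemma mem_colGroup_succ {n : ℕ} {u : Perm (Fin n)} {u' : Perm (Fin (n + 1))}
    (h : embPerm (n + 1) u' = embPerm n u) {σ : Perm (Fin n)} {σ' : Perm (Fin (n + 1))}
    (hσ : embPerm (n + 1) σ' = embPerm n σ) :
    σ' ∈ colGroup (n + 1) (tabP u') ↔ σ ∈ colGroup n (tabP u) := by
  have hT := isFilling_tabP u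
  have hcol (p : ℕ) (hp : p < n) :
      (colOf (tabP u') (embPerm n σ p) = colOf (tabP u') p ↔
        colOf (tabP u) (embPerm n σ p) = colOf (tabP u) p) := by
    rw [tabP_succ h, colOf_appendToRow hT (Nat.zero_le _) hp,
      colOf_appendToRow hT (Nat.zero_le _) ((embPerm_lt_iff σ p).mpr hp)]
  rw [mem_colGroup_iff, mem_colGroup_iff, hσ]
  constructor
  · exact fun h1 p hp => (hcol p hp).mp (h1 p (by omega))
  · intro h1 p hp
    rcases Nat.lt_succ_iff_lt_or_eq.mp hp with hp | rfl
    · exact (hcol p hp).mpr (h1 p hp)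
    · rw [embPerm_of_le σ le_rfl]

lemma exists_restrict {n : ℕ} {u : Perm (Fin n)} {u' : Perm (Fin (n + 1))}
    (h : embPerm (n + 1) u' = embPerm n u) {σ' : Perm (Fin (n + 1))}
    (hσ : σ' ∈ colGroup (n + 1) (tabP u')) :
    ∃ σ : Perm (Fin n), embPerm n σ = embPerm (n + 1) σ' := by
  have hT := isFilling_tabP u
  refine exists_embPerm fun i hi => ?_
  rcases eq_or_lt_of_le hi with rfl | hi
  · -- the new box is alone in its column
    have h1 := mem_colGroup_iff.mp hσ n (by omega)
    rw [tabP_succ h, colOf_appendToRow_self hT (Nat.zero_le _)] at h1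
    by_contra h2
    have h3 : embPerm (n + 1) σ' n < n := by
      have := (embPerm_lt_iff σ' n).mpr (by omega)
      omega
    rw [colOf_appendToRow hT (Nat.zero_le _) h3] at h1
    have h4 := colOf_lt (hT.mem_iff.mpr h3)
    have h5 : Antitone (rowLen (tabP u)) := by
      rw [rowLen_tabP]
      exact addBoxes_antitone zero_antitone (evWord_latt u)
    have h6 := h5 (Nat.zero_le (rowOf (tabP u) (embPerm (n + 1) σ' n)))
    omega
  · exact embPerm_of_le σ' (by omega)

lemma rowInf_succ {n : ℕ} {u : Perm (Fin n)} {u' : Perm (Fin (n + 1))}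
    (h : embPerm (n + 1) u' = embPerm n u) :
    rowInf (n + 1) (tabP u') = rowInf n (tabP u) := by
  have hT := isFilling_tabP u
  funext p
  rw [rowInf, rowInf, tabP_succ h]
  rcases lt_trichotomy p n with hp | rfl | hp
  · rw [if_pos (by omega), if_pos hp, rowOf_appendToRow hT (Nat.zero_le _) hp]
  · rw [if_pos (by omega), if_neg (by omega), rowOf_appendToRow_self hT (Nat.zero_le _)]
  · rw [if_neg (by omega), if_neg (by omega)]

/-- Adding a fixed point puts `n` at the end of the first row of `P`, where it belongs anyway in
`rowInf`, and changes neither the column group nor the non-zero exponents. -/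
lemma stableSeries_succ {n : ℕ} {u : Perm (Fin n)} {u' : Perm (Fin (n + 1))}
    (h : embPerm (n + 1) u' = embPerm n u) : stableSeries u' = stableSeries u := by
  classical
  choose ι hι hsign using fun v : Perm (Fin n) => exists_extend v
  ext f
  rw [coeff_stableSeries, coeff_stableSeries, rowInf_succ h, rowExpsNZ_succ h]
  symm
  refine Fintype.sum_bijective
    (fun σ : colGroup n (tabP u) => (⟨ι σ, (mem_colGroup_succ h (hι σ)).mpr σ.2⟩ :
      colGroup (n + 1) (tabP u'))) ⟨fun σ τ hστ => ?_, fun σ' => ?_⟩ _ _ fun σ => ?_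
  · have h1 : ι σ = ι τ := congrArg Subtype.val hστ
    refine Subtype.ext (embPerm_injective n ?_)
    rw [← hι, h1, hι]
  · obtain ⟨σ, hσ⟩ := exists_restrict h σ'.2
    refine ⟨⟨σ, (mem_colGroup_succ h hσ.symm).mp σ'.2⟩, Subtype.ext (embPerm_injective _ ?_)⟩
    rw [hι, hσ]
  · rw [hι, hsign]

theorem stableSeries_eq {n n' : ℕ} {u : Perm (Fin n)} {u' : Perm (Fin n')}
    (h : embPerm n' u' = embPerm n u) : stableSeries u' = stableSeries u := by
  wlog hn : n ≤ n' generalizing n n' u u'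
  · exact (this h.symm (by omega)).symm
  induction n', hn using Nat.le_induction with
  | base => rw [embPerm_injective n h]
  | succ k hk ih =>
    obtain ⟨v, hv⟩ := exists_embPerm (n := k) (σ := embPerm n u)
      fun i hi => embPerm_of_le u (hk.trans hi)
    rw [stableSeries_succ (h.trans hv.symm), ih hv]

/-! ### Truncation of the stable series -/

lemma exists_perm_of_map_eq {α β : Type*} [Fintype α] {f g : α → β}
    (h : Finset.univ.val.map f = Finset.univ.val.map g) : ∃ σ : Perm α, ∀ a, f (σ a) = g a := by
  classical
  have hcard (b : β) : Nonempty ({a // g a = b} ≃ {a // f a = b}) := by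
    have h1 := congrArg (Multiset.count b) h
    rw [Multiset.count_map, Multiset.count_map] at h1
    refine ⟨Fintype.equivOfCardEq ?_⟩
    rw [Fintype.card_subtype, Fintype.card_subtype, Finset.card_def, Finset.card_def]
    simpa only [eq_comm, Finset.filter_val] using h1.symm
  refine ⟨(Equiv.sigmaFiberEquiv g).symm.trans
    ((Equiv.sigmaCongrRight fun b => (hcard b).some).trans (Equiv.sigmaFiberEquiv f)), fun a => ?_⟩
  exact ((hcard (g a)).some ⟨a, rfl⟩).2

/-- Pairs with second component zero are counted by the first components. -/
lemma eq_of_filter_eq {A B : Multiset (ℕ × ℕ)} (h1 : A.map Prod.fst = B.map Prod.fst)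
    (h2 : A.filter (fun a => a.2 ≠ 0) = B.filter fun a => a.2 ≠ 0) : A = B := by
  have key (A : Multiset (ℕ × ℕ)) : A.filter (fun a => ¬ a.2 ≠ 0) =
      ((A.filter fun a => ¬ a.2 ≠ 0).map Prod.fst).map fun i => (i, 0) := by
    rw [Multiset.map_map]
    conv_lhs => rw [← Multiset.map_id (A.filter _)]
    refine Multiset.map_congr rfl fun a ha => ?_
    have := (Multiset.mem_filter.mp ha).2
    rw [not_not] at this
    exact Prod.ext rfl this
  have h3 : (A.filter fun a => ¬ a.2 ≠ 0).map Prod.fst =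
      (B.filter fun a => ¬ a.2 ≠ 0).map Prod.fst := by
    rw [← Multiset.filter_add_not (fun a : ℕ × ℕ => a.2 ≠ 0) A,
      ← Multiset.filter_add_not (fun a : ℕ × ℕ => a.2 ≠ 0) B, Multiset.map_add, Multiset.map_add,
      h2] at h1
    exact add_left_cancel h1
  rw [← Multiset.filter_add_not (fun a : ℕ × ℕ => a.2 ≠ 0) A,
    ← Multiset.filter_add_not (fun a : ℕ × ℕ => a.2 ≠ 0) B, h2, key A, key B, h3]

/-- The exponent of the variable `p` in the monomial `p_T^S` of `u`. -/
def spechtExp {n : ℕ} (u : Perm (Fin n)) (p : Fin n) : ℕ :=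
  entry (ct (tabQt u)) (rowOf (tabP u) p) (colOf (tabP u) p)

lemma range_eq_map_univ (n : ℕ) :
    Multiset.range n = (Finset.univ : Finset (Fin n)).val.map Fin.val := by
  have := congrArg Finset.val (Fin.map_valEmbedding_univ (n := n))
  rw [Nat.Iio_eq_range] at this
  exact this.symm

/-- In finitely many variables, the monomials with the exponents `rowExpsNZ u` form the orbit
of the monomial `p_T^S` under the row group. -/
lemma hasExps_embDomain_iff {n : ℕ} (u : Perm (Fin n)) (f : Fin n →₀ ℕ) :
    HasExps (rowInf n (tabP u)) (rowExpsNZ u) (Finsupp.embDomain Fin.valEmbedding f) ↔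
      ∃ τ ∈ rowGroup n (tabP u), ∀ p, f (τ p) = spechtExp u p := by
  have hL : ((Finsupp.embDomain Fin.valEmbedding f).support.val.map fun p =>
      (rowInf n (tabP u) p, Finsupp.embDomain Fin.valEmbedding f p)) =
      ((Finset.univ : Finset (Fin n)).val.map fun p : Fin n => (rowOf (tabP u) p, f p)).filter
        fun a => a.2 ≠ 0 := by
    have h1 : f.support.val = (Finset.univ : Finset (Fin n)).val.filter fun p => f p ≠ 0 := by
      rw [← Finset.filter_val]
      congr 1
      ext p
      simp
    rw [Finsupp.support_embDomain, Finset.map_val, Multiset.map_map, h1, Multiset.filter_map]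
    refine Multiset.map_congr rfl fun p _ => ?_
    have h2 := Finsupp.embDomain_apply_self Fin.valEmbedding f p
    simp only [Function.comp_apply, Fin.valEmbedding_apply, rowInf, p.2, if_true]
    exact Prod.ext rfl h2
  have hR : rowExps u = (Finset.univ : Finset (Fin n)).val.map fun p : Fin n =>
      (rowOf (tabP u) p, spechtExp u p) := by
    rw [rowExps, range_eq_map_univ, Multiset.map_map]
    rfl
  rw [HasExps, hL, rowExpsNZ, hR]
  constructor
  · intro h
    have h1 := eq_of_filter_eq (by rw [Multiset.map_map, Multiset.map_map]; rfl) h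
    obtain ⟨τ, hτ⟩ := exists_perm_of_map_eq h1
    exact ⟨τ, fun p => congrArg Prod.fst (hτ p), fun p => congrArg Prod.snd (hτ p)⟩
  · rintro ⟨τ, hτ, hf⟩
    congr 1
    have h1 : (Finset.univ : Finset (Fin n)).val.map τ = Finset.univ.val :=
      congrArg Finset.val (Finset.map_univ_equiv τ)
    conv_lhs => rw [← h1, Multiset.map_map]
    refine Multiset.map_congr rfl fun p _ => ?_
    rw [Function.comp_apply, hτ p, hf p]

lemma spechtMonomial_eq {n : ℕ} (u : Perm (Fin n)) :
    spechtMonomial n (tabP u) (tabQt u) =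
      MvPolynomial.monomial (Finsupp.equivFunOnFinite.symm (spechtExp u)) 1 := by
  rw [MvPolynomial.monomial_eq, map_one, one_mul, Finsupp.prod_fintype _ _ fun i => pow_zero _]
  rfl

lemma mapDomain_perm_eq_iff {n : ℕ} (ρ : Perm (Fin n)) (h f : Fin n →₀ ℕ) :
    Finsupp.mapDomain ρ h = f ↔ ∀ p, f (ρ p) = h p := by
  constructor
  · rintro rfl p
    exact Finsupp.mapDomain_apply ρ.injective h p
  · intro hf
    ext q
    obtain ⟨p, rfl⟩ := ρ.surjective q
    rw [Finsupp.mapDomain_apply ρ.injective, hf]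

lemma stabSize_eq {n : ℕ} (u : Perm (Fin n)) : stabSize n (tabP u) (tabQt u) =
    Nat.card {τ : rowGroup n (tabP u) //
      ∀ p, spechtExp u ((τ : Perm (Fin n)) p) = spechtExp u p} := by
  refine Nat.card_congr (Equiv.subtypeEquivRight fun τ => ?_)
  rw [spechtMonomial_eq, MvPolynomial.rename_monomial,
    MvPolynomial.monomial_left_inj one_ne_zero, mapDomain_perm_eq_iff]
  rfl

open scoped Classical in
/-- The orbit-stabilizer theorem for the row group acting on exponents. -/
lemma sum_rowGroup {n : ℕ} (u : Perm (Fin n)) (f : Fin n → ℕ) :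
    (∑ τ : rowGroup n (tabP u),
      if ∀ p, f ((τ : Perm (Fin n)) p) = spechtExp u p then (1 : ℚ) else 0) =
      if ∃ τ ∈ rowGroup n (tabP u), ∀ p, f (τ p) = spechtExp u p then
        (stabSize n (tabP u) (tabQt u) : ℚ) else 0 := by
  rw [Finset.sum_boole, ← Fintype.card_subtype, ← Nat.card_eq_fintype_card]
  split_ifs with h
  · obtain ⟨τ₀, h1, h2⟩ := h
    rw [stabSize_eq]
    congr 1
    refine (Nat.card_congr (Equiv.subtypeEquiv
      (Equiv.mulLeft (⟨τ₀, h1⟩ : rowGroup n (tabP u))) fun τ => ?_)).symm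
    have h3 (p : Fin n) : f (((Equiv.mulLeft (⟨τ₀, h1⟩ : rowGroup n (tabP u)) τ :
        rowGroup n (tabP u)) : Perm (Fin n)) p) = spechtExp u ((τ : Perm (Fin n)) p) := h2 _
    simp only [h3]
  · have : IsEmpty {τ : rowGroup n (tabP u) //
        ∀ p, f ((τ : Perm (Fin n)) p) = spechtExp u p} :=
      ⟨fun τ => h ⟨τ.1, τ.1.2, τ.2⟩⟩
    simp

lemma stabSize_ne_zero {n : ℕ} (u : Perm (Fin n)) :
    (stabSize n (tabP u) (tabQt u) : ℚ) ≠ 0 := by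
  rw [stabSize_eq, Nat.cast_ne_zero]
  have : Nonempty {τ : rowGroup n (tabP u) //
      ∀ p, spechtExp u ((τ : Perm (Fin n)) p) = spechtExp u p} := ⟨⟨1, fun _ => rfl⟩⟩
  exact Nat.card_pos.ne'

theorem truncVars_stableSeries {n : ℕ} (u : Perm (Fin n)) :
    truncVars n (stableSeries u) = (spechtPoly u : MvPowerSeries (Fin n) ℚ) := by
  classical
  ext f
  rw [truncVars, MvPowerSeries.coeff_killCompl, coeff_stableSeries, MvPolynomial.coeff_coe,
    spechtPoly, higherSpecht, youngSymm, MvPolynomial.coeff_smul, MvPolynomial.coeff_sum,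
    smul_eq_mul, Finset.mul_sum]
  refine Finset.sum_congr (by congr) fun σ _ => ?_
  have hact : actExp (embPerm n σ)⁻¹ (Finsupp.embDomain Fin.valEmbedding f) =
      Finsupp.embDomain Fin.valEmbedding (Finsupp.equivMapDomain (σ : Perm (Fin n))⁻¹ f) := by
    ext p
    rw [actExp_apply, inv_inv]
    by_cases hp : p < n
    · have h1 := Finsupp.embDomain_apply_self Fin.valEmbedding f ((σ : Perm (Fin n)) ⟨p, hp⟩)
      have h2 := Finsupp.embDomain_apply_self Fin.valEmbedding
        (Finsupp.equivMapDomain (σ : Perm (Fin n))⁻¹ f) ⟨p, hp⟩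
      rw [embPerm_of_lt _ hp]
      exact h1.trans h2.symm
    · have h1 : p ∉ Set.range (Fin.valEmbedding (n := n)) := by
        rintro ⟨q, rfl⟩
        exact hp q.2
      rw [embPerm_of_le _ (not_lt.mp hp), Finsupp.embDomain_of_notMem_range _ _ _ h1,
        Finsupp.embDomain_of_notMem_range _ _ _ h1]
  have hterm (τ : rowGroup n (tabP u)) :
      MvPolynomial.coeff f ((((Perm.sign (σ : Perm (Fin n)) : ℤ) : ℚ)) •
        MvPolynomial.rename ((σ : Perm (Fin n)) * (τ : Perm (Fin n)))
          (spechtMonomial n (tabP u) (tabQt u))) =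
      ((Perm.sign (σ : Perm (Fin n)) : ℤ) : ℚ) *
        if ∀ p, Finsupp.equivMapDomain (σ : Perm (Fin n))⁻¹ f ((τ : Perm (Fin n)) p) =
          spechtExp u p then 1 else 0 := by
    rw [MvPolynomial.coeff_smul, spechtMonomial_eq, MvPolynomial.rename_monomial,
      MvPolynomial.coeff_monomial, smul_eq_mul]
    congr 1
    exact if_congr (mapDomain_perm_eq_iff _ _ _) rfl rfl
  rw [MvPolynomial.coeff_sum, Finset.sum_congr rfl fun τ _ => hterm τ, ← Finset.mul_sum]
  rw [hact, if_congr (hasExps_embDomain_iff u _) rfl rfl]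
  have hsum := sum_rowGroup u (Finsupp.equivMapDomain (σ : Perm (Fin n))⁻¹ f)
  have h0 := stabSize_ne_zero u
  rw [show (∑ τ : rowGroup n (tabP u), _) = _ by convert hsum]
  split_ifs
  · field_simp
  · simp

/-! ### Uniqueness -/

/-- A monomial in at most `d` variables can be moved to one in the first `n ≥ m + d` variables
by a finite permutation fixing the first `m` indices. -/
lemma exists_actExp_support {m n : ℕ} (f : ℕ →₀ ℕ) (hn : m + f.degree ≤ n) :
    ∃ σ ∈ SInf, (∀ i, i < m → σ i = i) ∧ ∀ p ∈ (actExp σ f).support, p < n := by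
  classical
  let A := f.support.filter (m ≤ ·)
  have hA : A.card ≤ (Finset.Ico m n).card := by
    have h1 : f.support.card ≤ f.degree := by
      rw [Finset.card_eq_sum_ones]
      exact Finset.sum_le_sum fun i hi => Nat.one_le_iff_ne_zero.mpr (Finsupp.mem_support_iff.mp hi)
    have h2 := Finset.card_filter_le f.support (m ≤ ·)
    rw [Nat.card_Ico]
    change (f.support.filter (m ≤ ·)).card ≤ _
    omega
  obtain ⟨B, hB, hBA⟩ := Finset.exists_subset_card_eq hA
  let U := {x // x ∈ A ∪ B}
  let e : {x : U // x.1 ∈ A} ≃ {x : U // x.1 ∈ B} :=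
    Fintype.equivOfCardEq (by
      have hc (C : Finset ℕ) (hC : C ⊆ A ∪ B) : Fintype.card {x : U // x.1 ∈ C} = C.card := by
        rw [← Fintype.card_coe]
        exact Fintype.card_congr
          ⟨fun x => ⟨x.1.1, x.2⟩, fun x => ⟨⟨x.1, hC x.2⟩, x.2⟩, fun _ => rfl, fun _ => rfl⟩
      rw [hc A Finset.subset_union_left, hc B Finset.subset_union_right, hBA])
  let σ : Perm ℕ := Perm.ofSubtype e.extendSubtype
  have hout (i : ℕ) (hi : i ∉ A ∪ B) : σ i = i := Perm.ofSubtype_apply_of_not_mem _ hi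
  have hAB (i : ℕ) (hi : i ∈ A) : σ i ∈ B := by
    have h1 : i ∈ A ∪ B := Finset.mem_union_left _ hi
    have h2 : σ i = e.extendSubtype ⟨i, h1⟩ := Perm.ofSubtype_apply_of_mem _ h1
    rw [h2]
    exact e.extendSubtype_mem ⟨i, h1⟩ hi
  have hm (i : ℕ) (hi : i ∈ A ∪ B) : m ≤ i := by
    rcases Finset.mem_union.mp hi with hi | hi
    · exact (Finset.mem_filter.mp hi).2
    · exact (Finset.mem_Ico.mp (hB hi)).1
  refine ⟨σ, ⟨(A ∪ B).sup id + 1, fun i hi => hout i fun h => ?_⟩, fun i hi => hout i fun h => ?_,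
    fun p hp => ?_⟩
  · have := Finset.le_sup (f := id) h
    simp only [id] at this
    omega
  · have := hm i h
    omega
  · rw [Finsupp.mem_support_iff, actExp_apply, ← Finsupp.mem_support_iff] at hp
    obtain ⟨q, rfl⟩ := σ.surjective p
    rw [show σ⁻¹ (σ q) = q by simp] at hp
    by_cases hq : m ≤ q
    · exact (Finset.mem_Ico.mp (hB (hAB q (Finset.mem_filter.mpr ⟨hp, hq⟩)))).2
    · rw [hout q fun h => hq (hm q h)]
      omega

/-- A homogeneous series of degree `d` which is invariant under the finite permutations
fixing the first `m` indices is determined by its truncation to `n ≥ m + d` variables. -/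
theorem eq_of_truncVars_eq {m n d : ℕ} (hn : m + d ≤ n) {F G : MvPowerSeries ℕ ℚ}
    (hF : F.IsHomogeneous d) (hG : G.IsHomogeneous d)
    (hF' : ∀ σ ∈ SInf, (∀ i, i < m → σ i = i) → permAct σ F = F)
    (hG' : ∀ σ ∈ SInf, (∀ i, i < m → σ i = i) → permAct σ G = G)
    (h : truncVars n F = truncVars n G) : F = G := by
  ext f
  by_cases hd : f.degree = d
  · obtain ⟨σ, h1, h2, h3⟩ := exists_actExp_support (m := m) (n := n) f (by omega)
    have h4 : σ⁻¹ ∈ SInf := SInf.inv_mem h1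
    have h5 : ∀ i, i < m → σ⁻¹ i = i := fun i hi => by rw [Perm.inv_eq_iff_eq, h2 i hi]
    rw [← hF' _ h4 h5, ← hG' _ h4 h5, coeff_permAct, coeff_permAct, inv_inv]
    obtain ⟨g, hg⟩ : actExp σ f ∈ Set.range (Finsupp.embDomain (Fin.valEmbedding (n := n))) := by
      rw [Finsupp.mem_range_embDomain_iff]
      exact fun p hp => ⟨⟨p, h3 p hp⟩, rfl⟩
    have h6 := congrArg (MvPowerSeries.coeff g) h
    rw [truncVars, truncVars, MvPowerSeries.coeff_killCompl, MvPowerSeries.coeff_killCompl,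
      hg] at h6
    exact h6
  · rw [hF.coeff_eq_zero hd, hG.coeff_eq_zero hd]

end StableSpecht

theorem mainTheorem4 (w : SInf) :
    ∃ F : MvPowerSeries ℕ ℚ,
      -- homogeneity
      F.IsHomogeneous (∑ i ∈ dsl w, i) ∧
      -- substituting zero for all the variables but the first `n`
      (∀ (n : ℕ) (u : Equiv.Perm (Fin n)), embPerm n u = w →
        truncVars n F = (spechtPoly u : MvPowerSeries (Fin n) ℚ)) ∧
      -- the action of the extended column groups
      (∀ (n : ℕ) (u : Equiv.Perm (Fin n)), embPerm n u = w →
        ∃ χ : extColGroup n (tabP u) →* ℤˣ, IsExtSign χ ∧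
          ∀ g : extColGroup n (tabP u),
            permAct (embPerm n (g : Equiv.Perm (Fin n))) F = ((χ g : ℤ) : ℚ) • F) ∧
      -- invariance under all the permutations that fix the first `n` indices
      (∀ (n : ℕ) (u : Equiv.Perm (Fin n)), embPerm n u = w →
        ∀ σ : Equiv.Perm ℕ, (∀ i, i < n → σ i = i) → permAct σ F = F) ∧
      -- for large `n`, the series is determined by its truncation to `n` variables
      (∀ (m : ℕ) (v : Equiv.Perm (Fin m)), embPerm m v = w →
        ∃ N : ℕ, ∀ n : ℕ, N ≤ n → ∀ u : Equiv.Perm (Fin n), embPerm n u = w →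
          ∀ G : MvPowerSeries ℕ ℚ,
            G.IsHomogeneous (∑ i ∈ dsl w, i) →
            truncVars n G = (spechtPoly u : MvPowerSeries (Fin n) ℚ) →
            (∀ σ ∈ SInf, (∀ i, i < m → σ i = i) → permAct σ G = G) →
            G = F) := by
  obtain ⟨n₀, u₀, h₀⟩ := (mem_SInf_iff (w : Equiv.Perm ℕ)).mp w.2
  have heq {n : ℕ} {u : Equiv.Perm (Fin n)} (h : embPerm n u = w) :
      stableSeries u = stableSeries u₀ := stableSeries_eq (h.trans h₀.symm)
  have hhom : (stableSeries u₀).IsHomogeneous (∑ i ∈ dsl w, i) := by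
    rw [← sum_rowExpsNZ u₀ w h₀]
    exact isHomogeneous_stableSeries u₀
  refine ⟨stableSeries u₀, hhom, fun n u h => ?_, fun n u h => ?_, fun n u h σ hσ => ?_,
    fun m v hv => ⟨m + ∑ i ∈ dsl w, i, fun n hn u h G hG hG' hG'' => ?_⟩⟩
  · rw [← heq h, truncVars_stableSeries]
  · rw [← heq h]
    exact exists_extSign u
  · rw [← heq h]
    exact permAct_of_fixes u hσ
  · refine eq_of_truncVars_eq hn hG hhom hG'' (fun σ _ hσ => ?_) ?_
    · rw [← heq hv]
      exact permAct_of_fixes v hσ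
    · rw [hG', ← heq h, truncVars_stableSeries]
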